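/- **Unified fundamental equation of a pseudo-Finsler submersion.** *Setting.* A pseudo-Finsler metric on a smooth manifold $M$ is a smooth function $L:\mathcal A\to\mathbb R$ on an open subset $\mathcal A\subset TM\setminus 0$ invariant under multiplication by positive scalars, such that $L(\lambda v)=\lambda^2L(v)$ for $\lambda>0$ and such that for each $v\in\mathcal A$ the fundamental tensor $g_v(e,h)=\frac12\frac{\partial^2}{\partial s\,\partial t}L(v+se+th)|_{s=t=0}$ is non-degenerate on $T_{\pi(v)}M$. The elements of $\mathcal A$ are called admissible. An anisotropic vector field is a smooth map $v\mapsto\mathcal X_v\in T_{\pi(v)}M$ on $\mathcal A$; its fibre derivative is $\dot\partial\mathcal X_v(w)=\frac{d}{dt}\mathcal X_{v+tw}|_{t=0}$. An anisotropic connection assigns to vector fields $E,H$ an anisotropic vector field $\nabla_EH$, additive in both arguments, function-linear in $E$ and with the Leibniz rule in $H$; $\nabla^v_eH$ is its value at $v$, where $e=E_{\pi(v)}$. It acts on anisotropic vector fields by $\nabla^v_e\mathcal X=\nabla^v_e(\mathcal X_V)-\dot\partial\mathcal X_v(\nabla^v_eV)$ and on functions $f$ on $\mathcal A$ by $(\nabla_ef)(v)=e(f(V))-\frac{d}{dt}f(v+t\nabla^v_eV)|_{t=0}$,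 with $V$ any local extension of $v$, and on anisotropic tensors by the product rule. The Chern connection of $(M,L)$ is the unique anisotropic connection with $\nabla_EH-\nabla_HE=[E,H]$ and $\nabla g=0$. Its curvature is $$R_v(E,H)B=\nabla^v_E\nabla_HB-\nabla^v_H\nabla_EB-\nabla^v_{[E,H]}B .$$ Let $(M,L)$, $(B,\tilde L)$ be pseudo-Finsler manifolds and $\sigma:M\to B$ a pseudo-Finsler submersion: $\sigma$ is smooth, surjective, with surjective differentials; the restriction of $L$ to the tangent spaces of the fibres is a pseudo-Finsler metric on the fibres; and, writing $\mathcal V_p=\ker d\sigma_p$, every admissible $v$ that is $g_v$-orthogonal to $\mathcal V_{\pi(v)}$ satisfies $L(v)=\tilde L(d\sigma(v))$ (in particular $d\sigma(v)$ is admissible for $\tilde L$). Assume moreover that $g_v$ is non-degenerate on $\mathcal V_{\pi(v)}$ for every admissible $v$. Then each $e\in T_{\pi(v)}M$ splits uniquely as $e=e^\top_v+e^\bot_v$ with $e^\top_v\in\mathcal V_{\pi(v)}$ and $e^\bot_v$ $g_v$-orthogonal to $\mathcal V_{\pi(v)}$; for an anisotropic vector field put $(\mathcal X^\top)_v=(\mathcal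 X_v)^\top_v$ and $(\mathcal X^\bot)_v=(\mathcal X_v)^\bot_v$ (a vector field is seen as an anisotropic one). With $E$ any extension of $e$, put $$\chi^v_be=(\nabla^v_bE^\bot)^\top_v+(\nabla^v_bE^\top)^\bot_v,\qquad \mathbf T^v_be=\chi^v_{b^\top_v}e,\qquad \mathbf A^v_be=\chi^v_{b^\bot_v}e,$$ and, for extensions $E,H,B$ of $e,h,b$, $$R^\top_v(e,h)b=\bigl(\nabla^v_e(\nabla_HB^\top)^\top-\nabla^v_h(\nabla_EB^\top)^\top-\nabla^v_{[E,H]}B^\top\bigr)^\top_v,$$ $$R^\bot_v(e,h)b=\bigl(\nabla^v_e(\nabla_HB^\bot)^\bot-\nabla^v_h(\nabla_EB^\bot)^\bot-\nabla^v_{[E,H]}B^\bot\bigr)^\bot_v .$$ *Theorem.* For every admissible $v$, all vectors $e,h\in T_{\pi(v)}M$, as operators on $T_{\pi(v)}M$ (that is, applied to every $b\in T_{\pi(v)}M$, whatever local extensions of $e,h,b$ are used to compute the three curvatures), $$R_v(e,h)=R^\top_v(e,h)+R^\bot_v(e,h)+(\nabla_e(\mathbf T+\mathbf A))^v_h-(\nabla_h(\mathbf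 T+\mathbf A))^v_e+(\mathbf T+\mathbf A)^v_h(\mathbf T+\mathbf A)^v_e-(\mathbf T+\mathbf A)^v_e(\mathbf T+\mathbf A)^v_h .$$ -/

import Mathlib

open Bundle Filter Topology
open scoped Manifold ContDiff

noncomputable section

namespace PseudoFinsler

variable (E : Type*) [NormedAddCommGroup E] [NormedSpace ℝ E]
  (M : Type*) [TopologicalSpace M] [ChartedSpace E M] [IsManifold 𝓘(ℝ, E) ∞ M]

/-- The tangent bundle `TM` of a manifold `M` modelled on `E`. A point `v : TM E M` is a tangent
vector `v.2` at the point `v.1` of `M`. -/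
abbrev TM := TangentBundle 𝓘(ℝ, E) M

/-- Vector fields on `M`, not necessarily smooth. -/
abbrev VField := ∀ x : M, TangentSpace 𝓘(ℝ, E) x

/-- Anisotropic vector fields `v ↦ 𝒳_v ∈ T_{π(v)}M`, not necessarily smooth. -/
abbrev AnisotropicField := ∀ v : TM E M, TangentSpace 𝓘(ℝ, E) v.1

/-- Anisotropic tensors of type `(0,2)`: `g v e h` stands for `g_v(e,h)`. -/
abbrev AnisotropicForm :=
  ∀ v : TM E M, TangentSpace 𝓘(ℝ, E) v.1 → TangentSpace 𝓘(ℝ, E) v.1 → ℝ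

/-- Anisotropic tensors of type `(1,2)`: `Ξ v b e` stands for `Ξ^v_b e`. -/
abbrev AnisotropicTensor :=
  ∀ v : TM E M, TangentSpace 𝓘(ℝ, E) v.1 → TangentSpace 𝓘(ℝ, E) v.1 → TangentSpace 𝓘(ℝ, E) v.1

variable {E M}

/-- A vector field seen as a map `M → TM`. -/
def VField.toMap (X : VField E M) : M → TM E M := fun x => ⟨x, X x⟩

/-- The vector `v + w` at the base point of `v`. -/
def vadd (v : TM E M) (w : TangentSpace 𝓘(ℝ, E) v.1) : TM E M := ⟨v.1, v.2 + w⟩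

/-- `X` is a local extension of `e ∈ T_pM`: it takes the value `e` at `p` and it is a smooth vector
field on a neighbourhood of `p`. -/
def IsLocalExtension {p : M} (e : TangentSpace 𝓘(ℝ, E) p) (X : VField E M) : Prop :=
  X p = e ∧ ∀ᶠ x in 𝓝 p, ContMDiffAt 𝓘(ℝ, E) 𝓘(ℝ, E).tangent ∞ X.toMap x

/-- A particular local extension of `e ∈ T_pM`: the one with constant components in the preferred
chart at `p`. -/
def ext {p : M} (e : TangentSpace 𝓘(ℝ, E) p) : VField E M := FiberBundle.extend E e

/-! ### Pseudo-Finsler metrics -/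

/-- The second fibre derivative `g_v(e,h) = ½ ∂²/∂s∂t L(v + s e + t h)` at `s = t = 0`. -/
def fundamentalTensor (L : TM E M → ℝ) : AnisotropicForm E M := fun v e h =>
  (1 / 2) * deriv (fun s : ℝ => deriv (fun t : ℝ => L (vadd v (s • e + t • h))) 0) 0

variable (E M)

/-- A pseudo-Finsler metric on `M`, with its open conic domain `𝒜 ⊆ TM ∖ 0` of admissible
vectors. The values of `L` outside of `𝒜` are irrelevant. -/
structure Metric where
  /-- the set `𝒜` of admissible vectors -/
  adm : Set (TM E M)
  /-- the function `L : 𝒜 → ℝ` -/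
  L : TM E M → ℝ
  isOpen_adm : IsOpen adm
  ne_zero : ∀ v ∈ adm, v.2 ≠ 0
  smul_mem : ∀ v ∈ adm, ∀ r : ℝ, 0 < r → (⟨v.1, r • v.2⟩ : TM E M) ∈ adm
  smooth : ContMDiffOn 𝓘(ℝ, E).tangent 𝓘(ℝ, ℝ) ∞ L adm
  homogeneous : ∀ v ∈ adm, ∀ r : ℝ, 0 < r → L ⟨v.1, r • v.2⟩ = r ^ 2 * L v
  nondegenerate : ∀ v ∈ adm, ∀ e, (∀ h, fundamentalTensor L v e h = 0) → e = 0

variable {E M}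

/-- The fundamental tensor `g` of a pseudo-Finsler metric. -/
def Metric.g (m : Metric E M) : AnisotropicForm E M := fundamentalTensor m.L

/-! ### Anisotropic connections -/

variable (E M)

/-- An `𝒜`-anisotropic connection: `cov v H e` stands for `∇^v_e H`, with `v ∈ 𝒜` and
`e ∈ T_{π(v)}M`. The dependence of `∇_E H` on `E` being function-linear, `∇^v_E H` depends on `E`
only through `e = E_{π(v)}`, linearly. As is usual, the laws are imposed on all the vector fields
and functions that are differentiable at the point, which makes `∇^v_e H` meaningful for vector
fields that are only defined locally; other values are irrelevant. -/
structure AnisotropicConnection (A : Set (TM E M)) where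
  /-- `cov v H e = ∇^v_e H` -/
  cov : ∀ v : TM E M, VField E M → TangentSpace 𝓘(ℝ, E) v.1 →L[ℝ] TangentSpace 𝓘(ℝ, E) v.1
  add : ∀ v ∈ A, ∀ H B : VField E M,
    MDifferentiableAt 𝓘(ℝ, E) 𝓘(ℝ, E).tangent H.toMap v.1 →
    MDifferentiableAt 𝓘(ℝ, E) 𝓘(ℝ, E).tangent B.toMap v.1 →
    cov v (H + B) = cov v H + cov v B
  leibniz : ∀ v ∈ A, ∀ (f : M → ℝ) (H : VField E M),
    MDifferentiableAt 𝓘(ℝ, E) 𝓘(ℝ, ℝ) f v.1 →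
    MDifferentiableAt 𝓘(ℝ, E) 𝓘(ℝ, E).tangent H.toMap v.1 →
    ∀ e : TangentSpace 𝓘(ℝ, E) v.1, cov v (fun x => f x • H x) e =
      mvfderiv 𝓘(ℝ, E) f v.1 e • H v.1 + f v.1 • cov v H e
  smooth : ∀ X H : VField E M,
    ContMDiff 𝓘(ℝ, E) 𝓘(ℝ, E).tangent ∞ X.toMap → ContMDiff 𝓘(ℝ, E) 𝓘(ℝ, E).tangent ∞ H.toMap →
    ContMDiffOn 𝓘(ℝ, E).tangent 𝓘(ℝ, E).tangent ∞
      (fun v : TM E M => (⟨v.1, cov v H (X v.1)⟩ : TM E M)) A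

variable {E M}

/-- The fibre derivative `(∂̇_w 𝒳)_v = d/dt 𝒳_{v + t w}` at `t = 0`. -/
def fiberDeriv (X : AnisotropicField E M) (v : TM E M) (w : TangentSpace 𝓘(ℝ, E) v.1) :
    TangentSpace 𝓘(ℝ, E) v.1 :=
  deriv (fun t : ℝ => (X (vadd v (t • w)) : TangentSpace 𝓘(ℝ, E) v.1)) 0

namespace AnisotropicConnection

variable {A : Set (TM E M)} (D : AnisotropicConnection E M A)

/-- The derivative `(∇_e f)(v) = e(f(V)) - (∂̇_w f)(v)`, `w = ∇^v_e V`, of a function `f` of the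
admissible vectors, where `V` is a local extension of `v`. It does not depend on the extension. -/
def covFun (f : TM E M → ℝ) (v : TM E M) (e : TangentSpace 𝓘(ℝ, E) v.1) : ℝ :=
  mvfderiv 𝓘(ℝ, E) (fun x => f ((ext v.2).toMap x)) v.1 e -
    deriv (fun t : ℝ => f (vadd v (t • D.cov v (ext v.2) e))) 0

/-- The derivative `∇^v_e 𝒳 = ∇^v_e (𝒳_V) - (∂̇_w 𝒳)_v`, `w = ∇^v_e V`, of an anisotropic vector
field, where `V` is a local extension of `v`. It does not depend on the extension. -/
def covField (X : AnisotropicField E M) (v : TM E M) (e : TangentSpace 𝓘(ℝ, E) v.1) :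
    TangentSpace 𝓘(ℝ, E) v.1 :=
  D.cov v (fun x => X ((ext v.2).toMap x)) e - fiberDeriv X v (D.cov v (ext v.2) e)

/-- The anisotropic vector field `∇_Y 𝒳`. -/
def nabla (Y : VField E M) (X : AnisotropicField E M) : AnisotropicField E M :=
  fun u => D.covField X u (Y u.1)

/-- The covariant derivative `(∇_e g)_v(h,b)` of an anisotropic tensor of type `(0,2)`, through the
product rule. -/
def covForm (g : AnisotropicForm E M) (v : TM E M) (e h b : TangentSpace 𝓘(ℝ, E) v.1) : ℝ :=
  D.covFun (fun u => g u (ext h u.1) (ext b u.1)) v e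
    - g v (D.cov v (ext h) e) b - g v h (D.cov v (ext b) e)

/-- The covariant derivative `(∇_e Ξ)^v_h b` of an anisotropic tensor of type `(1,2)`, through the
product rule. -/
def covTensor (Ξ : AnisotropicTensor E M) (v : TM E M) (e h b : TangentSpace 𝓘(ℝ, E) v.1) :
    TangentSpace 𝓘(ℝ, E) v.1 :=
  D.covField (fun u => Ξ u (ext h u.1) (ext b u.1)) v e
    - Ξ v (D.cov v (ext h) e) b - Ξ v h (D.cov v (ext b) e)

/-- The curvature `R_v(X,Y)Z = ∇^v_X ∇_Y Z - ∇^v_Y ∇_X Z - ∇^v_{[X,Y]} Z`. -/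
def curvature (X Y Z : VField E M) (v : TM E M) : TangentSpace 𝓘(ℝ, E) v.1 :=
  D.covField (fun u => D.cov u Z (Y u.1)) v (X v.1)
    - D.covField (fun u => D.cov u Z (X u.1)) v (Y v.1)
    - D.cov v Z (VectorField.mlieBracket 𝓘(ℝ, E) X Y v.1)

end AnisotropicConnection

/-- `D` is the Levi-Civita–Chern connection of the pseudo-Finsler metric `m`: the (unique)
torsion-free anisotropic connection with `∇g = 0`. -/
structure Metric.IsChernConnection (m : Metric E M) (D : AnisotropicConnection E M m.adm) :
    Prop where
  torsion_free : ∀ v ∈ m.adm, ∀ X Y : VField E M,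
    MDifferentiableAt 𝓘(ℝ, E) 𝓘(ℝ, E).tangent X.toMap v.1 →
    MDifferentiableAt 𝓘(ℝ, E) 𝓘(ℝ, E).tangent Y.toMap v.1 →
    D.cov v Y (X v.1) - D.cov v X (Y v.1) - VectorField.mlieBracket 𝓘(ℝ, E) X Y v.1 = 0
  metric : ∀ v ∈ m.adm, ∀ e h b : TangentSpace 𝓘(ℝ, E) v.1, D.covForm m.g v e h b = 0

/-! ### Pseudo-Finsler submersions -/

variable {F : Type*} [NormedAddCommGroup F] [NormedSpace ℝ F]
  {B : Type*} [TopologicalSpace B] [ChartedSpace F B] [IsManifold 𝓘(ℝ, F) ∞ B]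

/-- The vertical space `𝒱_p = ker dσ_p`. -/
def vertical (E F : Type*) [NormedAddCommGroup E] [NormedSpace ℝ E]
    [NormedAddCommGroup F] [NormedSpace ℝ F]
    {M : Type*} [TopologicalSpace M] [ChartedSpace E M]
    {B : Type*} [TopologicalSpace B] [ChartedSpace F B] (σ : M → B) (p : M) :
    Submodule ℝ (TangentSpace 𝓘(ℝ, E) p) :=
  LinearMap.ker (mfderiv 𝓘(ℝ, E) 𝓘(ℝ, F) σ p).toLinearMap

/-- The restriction of `g_v` to the vertical space at the base point of `v` is non-degenerate. -/
def Metric.VerticalNondegenerate (m : Metric E M) (F : Type*) [NormedAddCommGroup F]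
    [NormedSpace ℝ F] {B : Type*} [TopologicalSpace B] [ChartedSpace F B] (σ : M → B)
    (v : TM E M) : Prop :=
  ∀ w ∈ vertical E F σ v.1, (∀ u ∈ vertical E F σ v.1, m.g v w u = 0) → w = 0

/-- `σ : (M, m) → (B, m')` is a pseudo-Finsler submersion. Since the tangent spaces of the fibres are
the vertical spaces, the fundamental tensor of the restriction of `L` to a fibre at a vertical
admissible `v` is the restriction of `g_v` to the vertical space; the other requirements on a
pseudo-Finsler metric are inherited by the restriction. -/
structure IsSubmersion (m : Metric E M) (m' : Metric F B) (σ : M → B) : Prop where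
  smooth : ContMDiff 𝓘(ℝ, E) 𝓘(ℝ, F) ∞ σ
  surjective : Function.Surjective σ
  surjective_mfderiv : ∀ p, Function.Surjective (mfderiv 𝓘(ℝ, E) 𝓘(ℝ, F) σ p)
  fibers_nondegenerate : ∀ v ∈ m.adm, v.2 ∈ vertical E F σ v.1 → m.VerticalNondegenerate F σ v
  preserves_length : ∀ v ∈ m.adm, (∀ w ∈ vertical E F σ v.1, m.g v v.2 w = 0) →
    (⟨σ v.1, mfderiv 𝓘(ℝ, E) 𝓘(ℝ, F) σ v.1 v.2⟩ : TM F B) ∈ m'.adm ∧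
    m.L v = m'.L ⟨σ v.1, mfderiv 𝓘(ℝ, E) 𝓘(ℝ, F) σ v.1 v.2⟩

section Decomposition

variable (m : Metric E M) (F)
variable {B : Type*} [TopologicalSpace B] [ChartedSpace F B] (σ : M → B)

open Classical in
/-- The vertical part `e^⊤_v` of `e`: the vertical vector such that `e - e^⊤_v` is `g_v`-orthogonal
to the vertical space. It exists and is unique when the vertical space is `g_v`-nondegenerate. -/
def vpart (v : TM E M) (e : TangentSpace 𝓘(ℝ, E) v.1) : TangentSpace 𝓘(ℝ, E) v.1 :=
  if h : ∃ w ∈ vertical E F σ v.1, ∀ u ∈ vertical E F σ v.1, m.g v (e - w) u = 0 then h.choose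
  else 0

/-- The `g_v`-horizontal part `e^⊥_v` of `e`. -/
def hpart (v : TM E M) (e : TangentSpace 𝓘(ℝ, E) v.1) : TangentSpace 𝓘(ℝ, E) v.1 :=
  e - vpart F m σ v e

/-- The anisotropic vector field `𝒳^⊤`, with `𝒳^⊤_v = (𝒳_v)^⊤_v`. -/
def top (X : AnisotropicField E M) : AnisotropicField E M := fun v => vpart F m σ v (X v)

/-- The anisotropic vector field `𝒳^⊥`, with `𝒳^⊥_v = (𝒳_v)^⊥_v`. -/
def bot (X : AnisotropicField E M) : AnisotropicField E M := fun v => hpart F m σ v (X v)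

/-- A vector field as an anisotropic vector field. -/
def iso (X : VField E M) : AnisotropicField E M := fun v => X v.1

variable (D : AnisotropicConnection E M m.adm)

/-- The tensor `χ^v_b e = (∇^v_b X^⊥)^⊤_v + (∇^v_b X^⊤)^⊥_v`, where `X` is a local extension
of `e`. It does not depend on the extension. -/
def chi : AnisotropicTensor E M := fun v b e =>
  vpart F m σ v (D.covField (bot F m σ (iso (ext e))) v b)
    + hpart F m σ v (D.covField (top F m σ (iso (ext e))) v b)

/-- The O'Neill tensor `T^v_b e = χ^v_{b^⊤} e`. -/
def tensorT : AnisotropicTensor E M := fun v b e => chi F m σ D v (vpart F m σ v b) e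

/-- The O'Neill tensor `A^v_b e = χ^v_{b^⊥} e`. -/
def tensorA : AnisotropicTensor E M := fun v b e => chi F m σ D v (hpart F m σ v b) e

/-- The vertical curvature
`R^⊤_v(X,Y)Z = (∇^v_X (∇_Y Z^⊤)^⊤ - ∇^v_Y (∇_X Z^⊤)^⊤ - ∇^v_{[X,Y]} Z^⊤)^⊤_v`. -/
def curvatureTop (X Y Z : VField E M) (v : TM E M) : TangentSpace 𝓘(ℝ, E) v.1 :=
  vpart F m σ v
    (D.covField (top F m σ (D.nabla Y (top F m σ (iso Z)))) v (X v.1)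
      - D.covField (top F m σ (D.nabla X (top F m σ (iso Z)))) v (Y v.1)
      - D.covField (top F m σ (iso Z)) v (VectorField.mlieBracket 𝓘(ℝ, E) X Y v.1))

/-- The horizontal curvature
`R^⊥_v(X,Y)Z = (∇^v_X (∇_Y Z^⊥)^⊥ - ∇^v_Y (∇_X Z^⊥)^⊥ - ∇^v_{[X,Y]} Z^⊥)^⊥_v`. -/
def curvatureBot (X Y Z : VField E M) (v : TM E M) : TangentSpace 𝓘(ℝ, E) v.1 :=
  hpart F m σ v
    (D.covField (bot F m σ (D.nabla Y (bot F m σ (iso Z)))) v (X v.1)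
      - D.covField (bot F m σ (D.nabla X (bot F m σ (iso Z)))) v (Y v.1)
      - D.covField (bot F m σ (iso Z)) v (VectorField.mlieBracket 𝓘(ℝ, E) X Y v.1))

end Decomposition

end PseudoFinsler

end

/-!
The projections `X ↦ X^⊤` and `X ↦ X^⊥` split an anisotropic vector field, so that
`∇̂_b X = (∇_b X^⊤)^⊤ + (∇_b X^⊥)^⊥` is another anisotropic connection, which preserves the vertical
and the horizontal fields. Since `(f X)^⊤ = f X^⊤` and `(f X)^⊥ = f X^⊥` for functions `f` of the
admissible vectors, the difference `∇ - ∇̂` is a tensor, and it is `χ = T + A`. Inserting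
`∇ = ∇̂ + χ` into `R(X, Y) Z` leaves the curvatures of the two summands of `∇̂`, the terms quadratic
in `χ`, the terms `(∇_X χ)_Y Z - (∇_Y χ)_X Z`, and `χ` applied to `∇_X Y - ∇_Y X - [X, Y]`, which
vanishes because the Chern connection has no torsion.

This computation needs derivatives of `v ↦ (∇_Y X^⊤)_v`, whereas the covariant derivative at `v` is
defined with the chart at the base point of `v`. It is therefore carried out in one bundle chart
`lift p : E × E → TM`. There an anisotropic vector field is a map `f : E × E → E`, the connection is
given by Christoffel symbols `G`, and the covariant derivative is
`∇_a f = Df (a, - G a y) + G a f` at `(x, y)` (`comps_covField`), independently of any extension.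
The algebra in this form is `Model.fundamental_equation`, for an arbitrary smooth field `P` of
projections. The transfer to the manifold rests on two regularity results.

* The Christoffel symbols are smooth (`contDiffOn_christoffel`): near a point, the constant vector
  fields of a chart agree with globally smooth ones, obtained from a bump function.
* The vertical projection is smooth (`contDiffAt_vproj`): the `g`-orthogonal projection to the
  kernel of `dσ` is the solution of a saddle point problem with Lagrange multipliers in the dual of the
  tangent space of the base, whose operator is invertible because `g` is nondegenerate on `ker dσ`
  and `dσ` is surjective, and it depends smoothly on the admissible vector.
-/

/-! ### Projected connections in coordinates -/

namespace PseudoFinsler.Model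

variable {E : Type*} [NormedAddCommGroup E] [NormedSpace ℝ E]
  (G : E × E → E →L[ℝ] E →L[ℝ] E) (P : E × E → E →L[ℝ] E)

/-- The horizontal lift of `a` to the point `z = (x, y)` of the tangent bundle in coordinates, for
the Christoffel symbols `G`, as a linear map in `a`. -/
noncomputable def hlift (z : E × E) : E →L[ℝ] E × E :=
  (ContinuousLinearMap.id ℝ E).prod (-((G z).flip z.2))

/-- The covariant derivative `∇_a f` of an anisotropic vector field `f` in coordinates. -/
noncomputable def nab (f : E × E → E) (z : E × E) (a : E) : E :=
  fderiv ℝ f z (hlift G z a) + G z a (f z)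

/-- The difference between `∇` and the connection `P ∘ ∇ ∘ P + (1 - P) ∘ ∇ ∘ (1 - P)`, in
coordinates. -/
noncomputable def diffTensor (z : E × E) : E →L[ℝ] E →L[ℝ] E :=
  (ContinuousLinearMap.compL ℝ E E E (P z)) ∘L
      (-(fderiv ℝ P z ∘L hlift G z) +
        (ContinuousLinearMap.compL ℝ E E E).flip (.id ℝ E - P z) ∘L G z) +
    (ContinuousLinearMap.compL ℝ E E E (.id ℝ E - P z)) ∘L
      (fderiv ℝ P z ∘L hlift G z + (ContinuousLinearMap.compL ℝ E E E).flip (P z) ∘L G z)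

/-- The covariant derivative `(∇_a K)(y, w)` of a field `K` of bilinear maps, in coordinates. -/
noncomputable def nabTensor (K : E × E → E →L[ℝ] E →L[ℝ] E) (z : E × E) (a y w : E) : E :=
  fderiv ℝ K z (hlift G z a) y w + G z a (K z y w) - K z (G z a y) w - K z y (G z a w)

/-- The curvature of the connection `Q ∘ ∇ ∘ Q` in coordinates, for a field `Q` of projections. The
vector `c` stands for the Lie bracket of `X` and `Y`. -/
noncomputable def projCurvature (Q : E × E → E →L[ℝ] E) (X Y Z : E × E → E) (c : E) (z : E × E) :
    E :=
  Q z (nab G (fun z => Q z (nab G (fun z => Q z (Z z)) z (Y z))) z (X z)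
    - nab G (fun z => Q z (nab G (fun z => Q z (Z z)) z (X z))) z (Y z)
    - nab G (fun z => Q z (Z z)) z c)

variable {G P} {z : E × E}

lemma hlift_apply (a : E) : hlift G z a = (a, -G z a z.2) := by simp [hlift]

lemma diffTensor_apply (a w : E) : diffTensor G P z a w =
    P z (-(fderiv ℝ P z (hlift G z a) w) + G z a (w - P z w)) +
      ((fderiv ℝ P z (hlift G z a) w + G z a (P z w)) -
        P z (fderiv ℝ P z (hlift G z a) w + G z a (P z w))) := by
  simp only [diffTensor, add_apply, ContinuousLinearMap.comp_apply, neg_apply,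
    ContinuousLinearMap.flip_apply, ContinuousLinearMap.compL_apply, sub_apply,
    ContinuousLinearMap.id_apply, map_add]
  abel

lemma nab_congr {f f' : E × E → E} (h : f =ᶠ[𝓝 z] f') (a : E) : nab G f z a = nab G f' z a := by
  simp [nab, h.fderiv_eq, h.self_of_nhds]

lemma nab_add {f f' : E × E → E} (hf : DifferentiableAt ℝ f z) (hf' : DifferentiableAt ℝ f' z)
    (a : E) : nab G (fun z => f z + f' z) z a = nab G f z a + nab G f' z a := by
  simp only [nab, fderiv_fun_add hf hf', map_add, add_apply]
  abel

lemma nab_clm_apply {T : E × E → E →L[ℝ] E} {f : E × E → E} (hT : DifferentiableAt ℝ T z)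
    (hf : DifferentiableAt ℝ f z) (a : E) :
    nab G (fun z => T z (f z)) z a =
      fderiv ℝ T z (hlift G z a) (f z) + T z (fderiv ℝ f z (hlift G z a)) + G z a (T z (f z)) := by
  simp only [nab, fderiv_clm_apply hT hf]
  simp
  abel

/-- The product rule for the covariant derivative of a field of bilinear maps. -/
lemma nab_bilin_apply {K : E × E → E →L[ℝ] E →L[ℝ] E} {Y Z : E × E → E}
    (hK : DifferentiableAt ℝ K z) (hY : DifferentiableAt ℝ Y z) (hZ : DifferentiableAt ℝ Z z)
    (a : E) :
    nab G (fun z => K z (Y z) (Z z)) z a =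
      nabTensor G K z a (Y z) (Z z) + K z (nab G Y z a) (Z z) + K z (Y z) (nab G Z z a) := by
  rw [nab_clm_apply (hK.clm_apply hY) hZ, fderiv_clm_apply hK hY]
  simp [nab, nabTensor]
  abel

lemma nab_top_add_nab_bot {f : E × E → E} (hP : DifferentiableAt ℝ P z)
    (hf : DifferentiableAt ℝ f z) (a : E) :
    nab G (fun z => P z (f z)) z a + nab G (fun z => f z - P z (f z)) z a = nab G f z a := by
  rw [← nab_add (by fun_prop) (by fun_prop)]
  simp

/-- Tensoriality of the difference of the two connections. -/
lemma diffTensor_apply_eq {f : E × E → E} (hP : DifferentiableAt ℝ P z)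
    (hPP : ∀ w, P z (P z w) = P z w) (hf : DifferentiableAt ℝ f z) (a : E) :
    P z (nab G (fun z => f z - P z (f z)) z a) +
      (nab G (fun z => P z (f z)) z a - P z (nab G (fun z => P z (f z)) z a)) =
    diffTensor G P z a (f z) := by
  have h := nab_top_add_nab_bot (G := G) hP hf a
  rw [← eq_sub_iff_add_eq'] at h
  rw [h, nab_clm_apply hP hf, diffTensor_apply, nab]
  simp only [map_sub, map_add, map_neg, hPP]
  abel

/-- The decomposition of `∇` into the projected connections and the difference tensor. -/
lemma nab_eq {f : E × E → E} (hP : DifferentiableAt ℝ P z)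
    (hPP : ∀ w, P z (P z w) = P z w) (hf : DifferentiableAt ℝ f z) (a : E) :
    nab G f z a = P z (nab G (fun z => P z (f z)) z a) +
      (nab G (fun z => f z - P z (f z)) z a - P z (nab G (fun z => f z - P z (f z)) z a)) +
      diffTensor G P z a (f z) := by
  rw [← diffTensor_apply_eq hP hPP hf, ← nab_top_add_nab_bot hP hf]
  abel

lemma contDiffAt_hlift {n : ℕ∞ω} (hG : ContDiffAt ℝ n G z) : ContDiffAt ℝ n (hlift G) z := by
  have h1 : ContDiffAt ℝ n (fun z : E × E => (G z).flip) z :=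
    (ContinuousLinearMap.flipₗᵢ ℝ E E E).toContinuousLinearEquiv.contDiff.contDiffAt.comp z hG
  have h2 : ContDiffAt ℝ n (fun z : E × E => -((G z).flip z.2)) z :=
    (h1.clm_apply contDiffAt_snd).neg
  have h3 : hlift G = fun z => ContinuousLinearMap.inl ℝ E E +
      ContinuousLinearMap.inr ℝ E E ∘L (-((G z).flip z.2)) := by
    ext z <;> simp [hlift]
  rw [h3]
  exact contDiffAt_const.add (contDiffAt_const.clm_comp h2)

lemma contDiffAt_nab {f Y : E × E → E} (hG : ContDiffAt ℝ 1 G z) (hf : ContDiffAt ℝ 2 f z)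
    (hY : ContDiffAt ℝ 1 Y z) : ContDiffAt ℝ 1 (fun z => nab G f z (Y z)) z :=
  ((hf.fderiv_right (m := 1) (by norm_num)).clm_apply ((contDiffAt_hlift hG).clm_apply hY)).add
    ((hG.clm_apply hY).clm_apply (hf.of_le (by norm_num)))

lemma contDiffAt_diffTensor (hG : ContDiffAt ℝ 1 G z) (hP : ContDiffAt ℝ 2 P z) :
    ContDiffAt ℝ 1 (diffTensor G P) z := by
  have hP1 : ContDiffAt ℝ 1 P z := hP.of_le (by norm_num)
  have hdP : ContDiffAt ℝ 1 (fun z => fderiv ℝ P z ∘L hlift G z) z :=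
    (hP.fderiv_right (m := 1) (by norm_num)).clm_comp (contDiffAt_hlift hG)
  have hQ1 : ContDiffAt ℝ 1 (fun z => .id ℝ E - P z) z := contDiffAt_const.sub hP1
  have hc {T : E × E → E →L[ℝ] E} (hT : ContDiffAt ℝ 1 T z) :
      ContDiffAt ℝ 1 (fun z => ContinuousLinearMap.compL ℝ E E E (T z)) z :=
    (ContinuousLinearMap.compL ℝ E E E).contDiff.contDiffAt.comp z hT
  have hc' {T : E × E → E →L[ℝ] E} (hT : ContDiffAt ℝ 1 T z) :
      ContDiffAt ℝ 1 (fun z => (ContinuousLinearMap.compL ℝ E E E).flip (T z)) z :=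
    (ContinuousLinearMap.compL ℝ E E E).flip.contDiff.contDiffAt.comp z hT
  exact ((hc hP1).clm_comp (hdP.neg.add ((hc' hQ1).clm_comp hG))).add
    ((hc hQ1).clm_comp (hdP.add ((hc' hP1).clm_comp hG)))

/-- The fundamental equation in coordinates. The vector `c` stands for the Lie bracket of `X` and
`Y`. -/
theorem fundamental_equation {X Y Z : E × E → E} (hG : ContDiffAt ℝ 1 G z)
    (hP : ContDiffAt ℝ 2 P z) (hPP : ∀ᶠ z in 𝓝 z, ∀ w, P z (P z w) = P z w)
    (hX : ContDiffAt ℝ 1 X z) (hY : ContDiffAt ℝ 1 Y z) (hZ : ContDiffAt ℝ 2 Z z) {c : E}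
    (hc : c = nab G Y z (X z) - nab G X z (Y z)) :
    nab G (fun z => nab G Z z (Y z)) z (X z) - nab G (fun z => nab G Z z (X z)) z (Y z)
        - nab G Z z c =
      projCurvature G P X Y Z c z + projCurvature G (fun z => .id ℝ E - P z) X Y Z c z
      + nabTensor G (diffTensor G P) z (X z) (Y z) (Z z)
      - nabTensor G (diffTensor G P) z (Y z) (X z) (Z z)
      + diffTensor G P z (Y z) (diffTensor G P z (X z) (Z z))
      - diffTensor G P z (X z) (diffTensor G P z (Y z) (Z z)) := by
  have hP1 : ContDiffAt ℝ 1 P z := hP.of_le (by norm_num)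
  have hdP : DifferentiableAt ℝ P z := hP1.differentiableAt one_ne_zero
  have hdZ : DifferentiableAt ℝ Z z := hZ.differentiableAt two_ne_zero
  have hPZ : ContDiffAt ℝ 2 (fun z => P z (Z z)) z := hP.clm_apply hZ
  have hQZ : ContDiffAt ℝ 2 (fun z => Z z - P z (Z z)) z := hZ.sub hPZ
  have hK := (contDiffAt_diffTensor hG hP).differentiableAt one_ne_zero
  have hPP' := hPP.self_of_nhds
  -- the second covariant derivative `∇_X ∇_Y Z`, for either order of `X` and `Y`
  have key {X Y : E × E → E} (hY : ContDiffAt ℝ 1 Y z) :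
      nab G (fun z => nab G Z z (Y z)) z (X z) =
        P z (nab G (fun z => P z (nab G (fun z => P z (Z z)) z (Y z))) z (X z))
        + (nab G (fun z => nab G (fun z => Z z - P z (Z z)) z (Y z)
              - P z (nab G (fun z => Z z - P z (Z z)) z (Y z))) z (X z)
          - P z (nab G (fun z => nab G (fun z => Z z - P z (Z z)) z (Y z)
              - P z (nab G (fun z => Z z - P z (Z z)) z (Y z))) z (X z)))
        + diffTensor G P z (X z) (nab G Z z (Y z) - diffTensor G P z (Y z) (Z z))
        + nabTensor G (diffTensor G P) z (X z) (Y z) (Z z)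
        + diffTensor G P z (nab G Y z (X z)) (Z z)
        + diffTensor G P z (Y z) (nab G Z z (X z)) := by
    have hNP : ContDiffAt ℝ 1 (fun z => nab G (fun z => P z (Z z)) z (Y z)) z :=
      contDiffAt_nab hG hPZ hY
    have hNQ : ContDiffAt ℝ 1 (fun z => nab G (fun z => Z z - P z (Z z)) z (Y z)) z :=
      contDiffAt_nab hG hQZ hY
    have hU := (hP1.clm_apply hNP).differentiableAt one_ne_zero
    have hW := (hNQ.sub (hP1.clm_apply hNQ)).differentiableAt one_ne_zero
    have hKY : DifferentiableAt ℝ (fun z => diffTensor G P z (Y z) (Z z)) z :=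
      (hK.clm_apply (hY.differentiableAt one_ne_zero)).clm_apply hdZ
    have hev : (fun z => nab G Z z (Y z)) =ᶠ[𝓝 z] fun z =>
        P z (nab G (fun z => P z (Z z)) z (Y z)) +
        (nab G (fun z => Z z - P z (Z z)) z (Y z)
          - P z (nab G (fun z => Z z - P z (Z z)) z (Y z)))
        + diffTensor G P z (Y z) (Z z) := by
      -- `∇_Y Z` is the sum of a vertical, a horizontal and a tensorial part near `z`
      filter_upwards [hPP, hP.eventually (by simp), hZ.eventually (by simp)] with z h1 h2 h3
      exact nab_eq (h2.differentiableAt two_ne_zero) h1 (h3.differentiableAt two_ne_zero) _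
    rw [nab_congr hev, nab_add (by exact hU.add hW) hKY, nab_add hU hW,
      nab_bilin_apply hK (hY.differentiableAt one_ne_zero) hdZ]
    have hev0 := hev.self_of_nhds
    have eU := nab_eq (G := G) hdP hPP' hU (X z)
    have eW := nab_eq (G := G) hdP hPP' hW (X z)
    dsimp only at hev0
    -- the vertical part is fixed by `P`, and the horizontal part is killed by `P`
    have hU1 : (fun z => P z (P z (nab G (fun z => P z (Z z)) z (Y z)))) =ᶠ[𝓝 z]
        fun z => P z (nab G (fun z => P z (Z z)) z (Y z)) := hPP.mono fun z h => h _
    have hU0 : (fun z => P z (nab G (fun z => P z (Z z)) z (Y z))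
        - P z (P z (nab G (fun z => P z (Z z)) z (Y z)))) =ᶠ[𝓝 z] fun _ => 0 :=
      hPP.mono fun z h => by simp [h]
    have hW0 : (fun z => P z (nab G (fun z => Z z - P z (Z z)) z (Y z)
          - P z (nab G (fun z => Z z - P z (Z z)) z (Y z)))) =ᶠ[𝓝 z] fun _ => 0 :=
      hPP.mono fun z h => by simp [h]
    have hW1 : (fun z => nab G (fun z => Z z - P z (Z z)) z (Y z)
          - P z (nab G (fun z => Z z - P z (Z z)) z (Y z))
        - P z (nab G (fun z => Z z - P z (Z z)) z (Y z)
          - P z (nab G (fun z => Z z - P z (Z z)) z (Y z)))) =ᶠ[𝓝 z]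
        fun z => nab G (fun z => Z z - P z (Z z)) z (Y z)
          - P z (nab G (fun z => Z z - P z (Z z)) z (Y z)) :=
      hPP.mono fun z h => by simp [h]
    have h0 : nab G (fun _ => (0 : E)) z (X z) = 0 := by simp [nab]
    rw [nab_congr hU1, nab_congr hU0, h0] at eU
    rw [nab_congr hW0, nab_congr hW1, h0] at eW
    conv_lhs => rw [eU, eW]
    rw [hev0]
    simp only [map_add, map_sub, map_zero]
    abel
  rw [key hX, key hY, nab_eq hdP hPP' hdZ c]
  have hcK : diffTensor G P z c (Z z) = diffTensor G P z (nab G Y z (X z)) (Z z)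
      - diffTensor G P z (nab G X z (Y z)) (Z z) := by rw [hc]; simp
  rw [hcK]
  simp only [projCurvature, sub_apply, ContinuousLinearMap.id_apply, map_sub]
  abel

end PseudoFinsler.Model

/-! ### Coordinates on the tangent bundle -/

namespace PseudoFinsler

open Model

variable {E : Type*} [NormedAddCommGroup E] [NormedSpace ℝ E]
  {M : Type*} [TopologicalSpace M] [ChartedSpace E M] [IsManifold 𝓘(ℝ, E) ∞ M]

/-- The components of a tangent vector at `q` in the preferred chart at `p`. -/
noncomputable def comps (p q : M) : TangentSpace 𝓘(ℝ, E) q →L[ℝ] E :=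
  (trivializationAt E (TangentSpace 𝓘(ℝ, E)) p).continuousLinearMapAt ℝ q

/-- The tangent vector at `q` with given components in the preferred chart at `p`. -/
noncomputable def frame (p q : M) : E →L[ℝ] TangentSpace 𝓘(ℝ, E) q :=
  (trivializationAt E (TangentSpace 𝓘(ℝ, E)) p).symmL ℝ q

/-- The inverse of the bundle chart of `TM` induced by the preferred chart at `p`. -/
noncomputable def lift (p : M) (z : E × E) : TM E M :=
  ⟨(extChartAt 𝓘(ℝ, E) p).symm z.1, frame p _ z.2⟩

/-- The part of a set `A` of tangent vectors over the domain of the preferred chart at `p`, in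
coordinates. -/
def coordDomain (p : M) (A : Set (TM E M)) : Set (E × E) :=
  {z | z.1 ∈ (extChartAt 𝓘(ℝ, E) p).target ∧ lift p z ∈ A}

/-- An anisotropic vector field in coordinates. -/
noncomputable def rep (p : M) (X : AnisotropicField E M) (z : E × E) : E :=
  comps p _ (X (lift p z))

variable {p q : M} {A : Set (TM E M)} {z : E × E}

lemma comps_frame (hq : q ∈ (chartAt E p).source) (a : E) : comps p q (frame p q a) = a :=
  Trivialization.continuousLinearMapAt_symmL _ hq a

lemma frame_comps (hq : q ∈ (chartAt E p).source) (e : TangentSpace 𝓘(ℝ, E) q) :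
    frame p q (comps p q e) = e :=
  Trivialization.symmL_continuousLinearMapAt _ hq e

lemma comps_injective (hq : q ∈ (chartAt E p).source) : Function.Injective (comps (E := E) p q) :=
  Function.LeftInverse.injective (frame_comps hq)

lemma comps_eq (hq : q ∈ (chartAt E p).source) (e : TangentSpace 𝓘(ℝ, E) q) :
    comps p q e = (trivializationAt E (TangentSpace 𝓘(ℝ, E)) p ⟨q, e⟩).2 :=
  Trivialization.continuousLinearMapAt_apply_of_mem ℝ _ hq _

lemma comps_eq_mvfderiv (hq : q ∈ (chartAt E p).source) (e : TangentSpace 𝓘(ℝ, E) q) :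
    comps p q e = mvfderiv 𝓘(ℝ, E) (extChartAt 𝓘(ℝ, E) p) q e := by
  have := TangentBundle.continuousLinearMapAt_trivializationAt (I := 𝓘(ℝ, E)) hq
  exact congr($this e)

omit [NormedSpace ℝ E] [IsManifold 𝓘(ℝ, E) ∞ M] in
lemma eventually_mem_source (hq : q ∈ (chartAt E p).source) :
    ∀ᶠ x in 𝓝 q, x ∈ (chartAt E p).source :=
  (chartAt E p).open_source.mem_nhds hq

lemma contMDiffAt_toMap_iff {n : ℕ∞ω} (hn : n ≤ ∞) {X : VField E M}
    (hq : q ∈ (chartAt E p).source) :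
    ContMDiffAt 𝓘(ℝ, E) 𝓘(ℝ, E).tangent n X.toMap q ↔
      ContMDiffAt 𝓘(ℝ, E) 𝓘(ℝ, E) n (fun x => comps p x (X x)) q := by
  have : IsManifold 𝓘(ℝ, E) (∞ + 1) M := inferInstanceAs (IsManifold 𝓘(ℝ, E) ∞ M)
  have : ContMDiffVectorBundle n E (TangentSpace 𝓘(ℝ, E) : M → Type _) 𝓘(ℝ, E) :=
    ContMDiffVectorBundle.of_le hn
  refine ((trivializationAt E (TangentSpace 𝓘(ℝ, E)) p).contMDiffAt_section_iff hq).trans ?_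
  apply EventuallyEq.contMDiffAt_iff
  filter_upwards [eventually_mem_source hq] with x hx
  exact (comps_eq hx _).symm

lemma mdifferentiableAt_toMap_iff {X : VField E M} (hq : q ∈ (chartAt E p).source) :
    MDifferentiableAt 𝓘(ℝ, E) 𝓘(ℝ, E).tangent X.toMap q ↔
      MDifferentiableAt 𝓘(ℝ, E) 𝓘(ℝ, E) (fun x => comps p x (X x)) q := by
  refine ((trivializationAt E (TangentSpace 𝓘(ℝ, E)) p).mdifferentiableAt_section_iff
    𝓘(ℝ, E) _ hq).trans ?_
  apply EventuallyEq.mdifferentiableAt_iff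
  filter_upwards [eventually_mem_source hq] with x hx
  exact (comps_eq hx _).symm

lemma contMDiffAt_frame {n : ℕ∞ω} (hn : n ≤ ∞) (hq : q ∈ (chartAt E p).source) (a : E) :
    ContMDiffAt 𝓘(ℝ, E) 𝓘(ℝ, E).tangent n (VField.toMap fun x => frame p x a) q := by
  rw [contMDiffAt_toMap_iff hn hq]
  refine (contMDiffAt_const (c := a)).congr_of_eventuallyEq ?_
  filter_upwards [eventually_mem_source hq] with x hx
  exact comps_frame hx a

lemma mdifferentiableAt_frame (hq : q ∈ (chartAt E p).source) (a : E) :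
    MDifferentiableAt 𝓘(ℝ, E) 𝓘(ℝ, E).tangent (VField.toMap fun x => frame p x a) q :=
  (contMDiffAt_frame (n := 1) (by simp) hq a).mdifferentiableAt one_ne_zero

lemma lift_fst_mem (hz : z.1 ∈ (extChartAt 𝓘(ℝ, E) p).target) :
    (lift p z).1 ∈ (chartAt E p).source := by
  rw [← extChartAt_source 𝓘(ℝ, E)]
  exact (extChartAt 𝓘(ℝ, E) p).map_target hz

lemma exists_lift_eq (v : TM E M) :
    ∃ p, ∃ z : E × E, z.1 ∈ (extChartAt 𝓘(ℝ, E) p).target ∧ p = (lift p z).1 ∧ v = lift p z := by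
  have h : lift v.1 (extChartAt 𝓘(ℝ, E) v.1 v.1, comps v.1 v.1 v.2) = v := by
    obtain ⟨p, e⟩ := v
    have h1 : (extChartAt 𝓘(ℝ, E) p).symm (extChartAt 𝓘(ℝ, E) p p) = p := by simp
    simp only [lift]
    rw [h1, frame_comps (mem_chart_source E p)]
  exact ⟨v.1, _, mem_extChartAt_target v.1, by rw [h], h.symm⟩

lemma contMDiffAt_lift (hz : z.1 ∈ (extChartAt 𝓘(ℝ, E) p).target) :
    ContMDiffAt 𝓘(ℝ, E × E) 𝓘(ℝ, E).tangent ∞ (lift p) z := by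
  have hs := lift_fst_mem hz
  have : IsManifold 𝓘(ℝ, E) (∞ + 1) M := inferInstanceAs (IsManifold 𝓘(ℝ, E) ∞ M)
  have : ContMDiffVectorBundle ∞ E (TangentSpace 𝓘(ℝ, E) : M → Type _) 𝓘(ℝ, E) := inferInstance
  have hopen : (extChartAt 𝓘(ℝ, E) p).target ∈ 𝓝 z.1 :=
    (isOpen_extChartAt_target p).mem_nhds hz
  refine ((trivializationAt E (TangentSpace 𝓘(ℝ, E)) p).contMDiffAt_iff hs).2 ⟨?_, ?_⟩
  · exact ((contMDiffOn_extChartAt_symm p).contMDiffAt hopen).comp z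
      contDiffAt_fst.contMDiffAt
  · refine contDiffAt_snd.contMDiffAt.congr_of_eventuallyEq ?_
    filter_upwards [continuousAt_fst hopen] with x hx
    have hx' := lift_fst_mem (p := p) hx
    exact (comps_eq hx' _).symm.trans (comps_frame hx' _)

lemma isOpen_coordDomain (hA : IsOpen A) : IsOpen (coordDomain p A) := by
  rw [isOpen_iff_mem_nhds]
  intro z hz
  exact inter_mem (continuousAt_fst ((isOpen_extChartAt_target p).mem_nhds hz.1))
    ((contMDiffAt_lift hz.1).continuousAt (hA.mem_nhds hz.2))

lemma contDiffAt_rep_of_contMDiffAt {X : VField E M} {n : ℕ∞ω} (hn : n ≤ ∞)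
    (hz : z.1 ∈ (extChartAt 𝓘(ℝ, E) p).target)
    (hX : ContMDiffAt 𝓘(ℝ, E) 𝓘(ℝ, E).tangent n X.toMap (lift p z).1) :
    ContDiffAt ℝ n (rep p (iso X)) z := by
  rw [contMDiffAt_toMap_iff hn (lift_fst_mem hz)] at hX
  have hopen : (extChartAt 𝓘(ℝ, E) p).target ∈ 𝓝 z.1 :=
    (isOpen_extChartAt_target p).mem_nhds hz
  rw [← contMDiffAt_iff_contDiffAt]
  exact hX.comp z ((((contMDiffOn_extChartAt_symm p).contMDiffAt hopen).of_le hn).comp z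
      contDiffAt_fst.contMDiffAt)

lemma lift_add_smul (z : E × E) (t : ℝ) (w : TangentSpace 𝓘(ℝ, E) (lift p z).1)
    (hz : z.1 ∈ (extChartAt 𝓘(ℝ, E) p).target) :
    vadd (lift p z) (t • w) = lift p (z + t • (0, comps p _ w)) := by
  have h : frame p (lift p z).1 (z.2 + t • comps p _ w) = frame p (lift p z).1 z.2 + t • w := by
    rw [map_add, map_smul, frame_comps (lift_fst_mem hz)]
  have h' : z + t • ((0 : E), comps p _ w) = (z.1, z.2 + t • comps p _ w) := by
    ext <;> simp
  rw [h']
  exact congrArg (TotalSpace.mk (F := E) (E := TangentSpace 𝓘(ℝ, E)) (lift p z).1) h.symm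

lemma lift_add (z : E × E) (w : TangentSpace 𝓘(ℝ, E) (lift p z).1)
    (hz : z.1 ∈ (extChartAt 𝓘(ℝ, E) p).target) :
    vadd (lift p z) w = lift p (z + (0, comps p _ w)) := by
  simpa using lift_add_smul z 1 w hz

end PseudoFinsler

/-! ### Anisotropic connections in coordinates -/

namespace PseudoFinsler

open Model

variable {E : Type*} [NormedAddCommGroup E] [NormedSpace ℝ E] [FiniteDimensional ℝ E]
  {M : Type*} [TopologicalSpace M] [ChartedSpace E M] [IsManifold 𝓘(ℝ, E) ∞ M]

namespace AnisotropicConnection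

variable {A : Set (TM E M)} (D : AnisotropicConnection E M A) {p : M} {z : E × E}

/-- The Christoffel symbols of an anisotropic connection: `christoffel p z a w` is the derivative
in the direction `a` of the vector field with constant components `w` in the preferred chart at
`p`. -/
noncomputable def christoffel (p : M) (z : E × E) : E →L[ℝ] E →L[ℝ] E :=
  (∑ i, (ContinuousLinearMap.smulRightL ℝ E E
      ((Module.finBasis ℝ E).coord i).toContinuousLinearMap) ∘L
    (comps p _ ∘L D.cov (lift p z) (fun x => frame p x (Module.finBasis ℝ E i)) ∘L frame p _))

variable {D}

omit [FiniteDimensional ℝ E] in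
/-- In coordinates, the covariant derivative minus the componentwise derivative is tensorial. -/
lemma tensorialAt (u : TM E M) (hu : u ∈ A) (hp : u.1 ∈ (chartAt E p).source)
    (e : TangentSpace 𝓘(ℝ, E) u.1) :
    TensorialAt 𝓘(ℝ, E) E (fun H : VField E M => comps p u.1 (D.cov u H e) -
      mvfderiv 𝓘(ℝ, E) (fun x => comps p x (H x)) u.1 e) u.1 where
  smul {f H} hf hH := by
    have hH' := (mdifferentiableAt_toMap_iff (X := H) hp).1 hH
    have h1 : D.cov u (f • H) e = _ := D.leibniz u hu f H hf hH e
    have h2 : (fun x => comps p x ((f • H) x)) = fun x => f x • comps p x (H x) := by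
      ext x; simp
    rw [h1, h2]
    have h3 : mvfderiv 𝓘(ℝ, E) (fun x => f x • comps p x (H x)) u.1 e = _ :=
      congr($(mvfderiv_smul hf hH') e)
    rw [h3]
    simp [smul_sub]
    abel
  add {H H'} hH hH' := by
    have h1 : D.cov u (H + H') = _ := D.add u hu H H' hH hH'
    have h2 : (fun x => comps p x ((H + H') x)) =
        (fun x => comps p x (H x)) + fun x => comps p x (H' x) := by
      ext x; simp
    rw [h1, h2, mvfderiv_add ((mdifferentiableAt_toMap_iff hp).1 hH)
      ((mdifferentiableAt_toMap_iff hp).1 hH')]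
    simp
    abel

omit [FiniteDimensional ℝ E] [IsManifold 𝓘(ℝ, E) ∞ M] in
lemma mvfderiv_congr {f f' : M → E} {q : M} (h : f =ᶠ[𝓝 q] f') :
    mvfderiv 𝓘(ℝ, E) f q = mvfderiv 𝓘(ℝ, E) f' q := by
  ext e
  exact congr($(h.mfderiv_eq (I := 𝓘(ℝ, E)) (I' := 𝓘(ℝ, E))) e)

omit [FiniteDimensional ℝ E] in
lemma mvfderiv_comps_frame {q : M} (hq : q ∈ (chartAt E p).source) (a : E) :
    mvfderiv 𝓘(ℝ, E) (fun x => comps p x (frame p x a)) q = 0 := by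
  have h : (fun x => comps p x (frame p x a)) =ᶠ[𝓝 q] fun _ => a := by
    filter_upwards [eventually_mem_source hq] with x hx
    exact comps_frame hx a
  rw [mvfderiv_congr h]
  exact mvfderiv_const a

lemma comps_cov_frame (hz : z ∈ coordDomain p A) (a w : E) :
    comps p _ (D.cov (lift p z) (fun x => frame p x w) (frame p _ a)) =
      D.christoffel p z a w := by
  have hp := lift_fst_mem hz.1
  have hT := tensorialAt (D := D) (p := p) _ hz.2 hp (frame p _ a)
  have hw : (fun x => frame p x w) = fun x : M => ∑ i, ((fun _ : M =>
      (Module.finBasis ℝ E).repr w i) • fun x => frame p x (Module.finBasis ℝ E i)) x := by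
    ext x
    have := congrArg (frame p x) ((Module.finBasis ℝ E).sum_repr w)
    rw [← this]
    simp only [map_sum, map_smul, Pi.smul_apply']
  have hfr (i) := mdifferentiableAt_frame hp (Module.finBasis ℝ E i)
  have h1 := hT.sum (s := Finset.univ) (fun i => ((fun _ : M =>
      (Module.finBasis ℝ E).repr w i) • fun x => frame p x (Module.finBasis ℝ E i)))
      (fun i _ => mdifferentiableAt_const.smul_section (hfr i))
  rw [← hw] at h1
  rw [mvfderiv_comps_frame hp] at h1
  have h2 (i) := hT.smul (f := fun _ => (Module.finBasis ℝ E).repr w i)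
    mdifferentiableAt_const (hfr i)
  simp only [h2, mvfderiv_comps_frame hp] at h1
  simp only [christoffel]
  simpa using h1

/-- The covariant derivative of a vector field in coordinates. -/
lemma comps_cov (hz : z ∈ coordDomain p A) {H : VField E M}
    (hH : MDifferentiableAt 𝓘(ℝ, E) 𝓘(ℝ, E).tangent H.toMap (lift p z).1)
    (e : TangentSpace 𝓘(ℝ, E) (lift p z).1) :
    comps p _ (D.cov (lift p z) H e) =
      mvfderiv 𝓘(ℝ, E) (fun x => comps p x (H x)) (lift p z).1 e +
        D.christoffel p z (comps p _ e) (comps p _ (H (lift p z).1)) := by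
  have hp := lift_fst_mem hz.1
  have hT := tensorialAt (D := D) (p := p) _ hz.2 hp e
  have h1 := hT.pointwise hH (mdifferentiableAt_frame hp (comps p _ (H (lift p z).1)))
    (frame_comps hp _).symm
  have h2 := comps_cov_frame (D := D) hz (comps p _ e) (comps p _ (H (lift p z).1))
  rw [frame_comps hp] at h2
  rw [mvfderiv_comps_frame hp, h2] at h1
  rw [← sub_eq_iff_eq_add']
  simpa using h1

lemma contDiffOn_christoffel [T2Space M] (hA : IsOpen A) :
    ContDiffOn ℝ ∞ (D.christoffel p) (coordDomain p A) := by
  rw [contDiffOn_clm_apply]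
  intro a
  rw [contDiffOn_clm_apply]
  intro w z hz
  have hp := lift_fst_mem hz.1
  have hopen := isOpen_coordDomain (p := p) hA
  -- smooth vector fields on `M` that agree with the frame near the base point
  obtain ⟨ρ, -, hρ⟩ := (SmoothBumpFunction.nhds_basis_tsupport (I := 𝓘(ℝ, E))
    (lift p z).1).mem_iff.1 ((chartAt E p).open_source.mem_nhds hp)
  have hsm (c : E) : ContMDiff 𝓘(ℝ, E) 𝓘(ℝ, E).tangent ∞
      (VField.toMap ((ρ : M → ℝ) • fun x => frame p x c)) := by
    have : IsManifold 𝓘(ℝ, E) (∞ + 1) M := inferInstanceAs (IsManifold 𝓘(ℝ, E) ∞ M)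
    exact ContMDiffOn.smul_section_of_tsupport ρ.contMDiff.contMDiffOn (chartAt E p).open_source hρ
      fun x hx => (contMDiffAt_frame le_rfl hx c).contMDiffWithinAt
  have hev (c : E) : ∀ᶠ x in 𝓝 (lift p z).1, ((ρ : M → ℝ) • fun x => frame (E := E) p x c) x =
      frame p x c := by
    filter_upwards [ρ.eventuallyEq_one] with x hx
    simp [hx]
  have hD := (D.smooth _ _ (hsm a) (hsm w)).comp
    (fun z hz => (contMDiffAt_lift hz.1).contMDiffWithinAt) (s := coordDomain p A) fun z hz => hz.2
  have hD' := hD.contMDiffAt (hopen.mem_nhds hz)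
  have : IsManifold 𝓘(ℝ, E) (∞ + 1) M := inferInstanceAs (IsManifold 𝓘(ℝ, E) ∞ M)
  have h2 := (((trivializationAt E (TangentSpace 𝓘(ℝ, E)) p).contMDiffAt_iff
    (by exact hp)).1 hD').2
  rw [contMDiffAt_iff_contDiffAt] at h2
  refine (h2.congr_of_eventuallyEq ?_).contDiffWithinAt
  have hc : ContinuousAt (fun z : E × E => (lift p z).1) z := by
    have h := (contMDiffAt_lift (p := p) hz.1).continuousAt
    exact (FiberBundle.continuous_proj E (TangentSpace 𝓘(ℝ, E))).continuousAt.comp h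
  filter_upwards [hopen.mem_nhds hz, hc (eventually_eventually_nhds.2 (hev a)),
    hc (eventually_eventually_nhds.2 (hev w))] with z hz h1 h2
  have hp := lift_fst_mem hz.1
  -- `∇` only depends on the germ of a vector field, so that the cut-off does not change it
  have h3 := (tensorialAt (D := D) (p := p) _ hz.2 hp (frame p _ a)).local
    ((hsm w).mdifferentiableAt (by simp)) (mdifferentiableAt_frame hp w) h2
  rw [mvfderiv_congr (h2.mono fun x hx => congrArg (comps p x) hx), sub_left_inj] at h3
  rw [← comps_cov_frame hz]
  refine Eq.trans ?_ (comps_eq hp (D.cov (lift p z) ((ρ : M → ℝ) • fun x => frame (E := E) p x w)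
    (((ρ : M → ℝ) • fun x => frame (E := E) p x a) (lift p z).1)))
  rw [h1.self_of_nhds]
  exact h3.symm

omit [FiniteDimensional ℝ E] in
lemma deriv_frame {q : M} {f : ℝ → E} {f' : E} {t : ℝ} (hf : HasDerivAt f f' t) :
    deriv (fun t => frame p q (f t)) t = frame p q f' := by
  -- the tangent space is the model space by definition
  let T : E →L[ℝ] E := frame p q
  have h : HasDerivAt (fun t => T (f t)) (T f') t := T.hasFDerivAt.comp_hasDerivAt t hf
  exact h.deriv

/-- The covariant derivative of an anisotropic vector field in coordinates. -/
lemma comps_covField (hz : z ∈ coordDomain p A) {X : AnisotropicField E M}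
    (hX : DifferentiableAt ℝ (rep p X) z) (e : TangentSpace 𝓘(ℝ, E) (lift p z).1) :
    comps p _ (D.covField X (lift p z) e) = nab (D.christoffel p) (rep p X) z (comps p _ e) := by
  have hp := lift_fst_mem hz.1
  set V : VField E M := ext (lift p z).2 with hV
  have hVz : V (lift p z).1 = (lift p z).2 := FiberBundle.extend_apply_self E _
  have hVd : MDifferentiableAt 𝓘(ℝ, E) 𝓘(ℝ, E).tangent V.toMap (lift p z).1 :=
    FiberBundle.mdifferentiableAt_extend 𝓘(ℝ, E) E _
  have hVd' := (mdifferentiableAt_toMap_iff hp).1 hVd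
  have hχ : MDifferentiableAt 𝓘(ℝ, E) 𝓘(ℝ, E) (extChartAt 𝓘(ℝ, E) p) (lift p z).1 :=
    mdifferentiableAt_extChartAt hp
  -- the map `M → TM` given by `V`, in coordinates on `TM`
  let c : M → E × E := fun x => (extChartAt 𝓘(ℝ, E) p x, comps p x (V x))
  have hc : MDifferentiableAt 𝓘(ℝ, E) 𝓘(ℝ, E × E) c (lift p z).1 := hχ.prodMk_space hVd'
  have hcz : c (lift p z).1 = z := by
    ext
    · exact (extChartAt 𝓘(ℝ, E) p).right_inv hz.1
    · change comps p _ (V _) = _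
      rw [hVz]
      exact comps_frame hp _
  have hlift : ∀ᶠ x in 𝓝 (lift p z).1, comps p x (X (V.toMap x)) = rep p X (c x) := by
    filter_upwards [eventually_mem_source hp] with x hx
    have : lift p (c x) = V.toMap x := by
      have h1 : (extChartAt 𝓘(ℝ, E) p).symm (extChartAt 𝓘(ℝ, E) p x) = x :=
        (extChartAt 𝓘(ℝ, E) p).left_inv (by simpa using hx)
      simp only [lift, c, VField.toMap]
      rw [h1, frame_comps hx]
    rw [rep, this]
    rfl
  have hX' : DifferentiableAt ℝ (rep p X) (c (lift p z).1) := by rwa [hcz]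
  have hXc : MDifferentiableAt 𝓘(ℝ, E) 𝓘(ℝ, E) (fun x => rep p X (c x)) (lift p z).1 :=
    hX'.mdifferentiableAt.comp _ hc
  -- `X ∘ V` is a differentiable vector field, with components `rep p X ∘ c`
  have hH : MDifferentiableAt 𝓘(ℝ, E) 𝓘(ℝ, E).tangent
      (VField.toMap fun x => X (V.toMap x)) (lift p z).1 :=
    (mdifferentiableAt_toMap_iff hp).2 (hXc.congr_of_eventuallyEq hlift)
  have hfib : fiberDeriv X (lift p z) (D.cov (lift p z) V e) =
      frame p _ (fderiv ℝ (rep p X) z (0, comps p _ (D.cov (lift p z) V e))) := by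
    set w := D.cov (lift p z) V e
    have h1 : HasDerivAt (fun t : ℝ => z + t • ((0 : E), comps p _ w)) (0, comps p _ w) 0 := by
      simpa using ((hasDerivAt_id (0 : ℝ)).smul_const ((0 : E), comps p _ w)).const_add z
    have h2 : HasFDerivAt (rep p X) (fderiv ℝ (rep p X) z)
        (z + (0 : ℝ) • ((0 : E), comps p _ w)) := by
      simpa using hX.hasFDerivAt
    have h3 := h2.comp_hasDerivAt 0 h1
    refine Eq.trans ?_ (deriv_frame (p := p) (q := (lift p z).1) h3)
    rw [fiberDeriv]
    congr 1
    ext t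
    rw [Function.comp_apply, rep, ← lift_add_smul z t w hz.1]
    exact (frame_comps hp _).symm
  have hmf : mvfderiv 𝓘(ℝ, E) (fun x => rep p X (c x)) (lift p z).1 e =
      fderiv ℝ (rep p X) z (comps p _ e,
        mvfderiv 𝓘(ℝ, E) (fun x => comps p x (V x)) (lift p z).1 e) := by
    have h0 : HasMFDerivAt 𝓘(ℝ, E) 𝓘(ℝ, E × E) c (lift p z).1 _ :=
      ⟨hc.continuousAt, hχ.hasMFDerivAt.2.prodMk hVd'.hasMFDerivAt.2⟩
    have h1 := hX'.hasFDerivAt.hasMFDerivAt.comp _ h0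
    rw [hcz] at h1
    rw [comps_eq_mvfderiv hp]
    exact congr($(h1.mfderiv) e)
  have hV1 := comps_cov (D := D) hz hVd e
  rw [hVz, show comps p _ (lift p z).2 = z.2 from comps_frame hp _] at hV1
  rw [covField, map_sub, comps_cov hz hH, mvfderiv_congr hlift, hmf, hfib, comps_frame hp, hV1, nab,
    hlift_apply]
  have hVX : comps p (lift p z).1 (X (V.toMap (lift p z).1)) = rep p X z :=
    hlift.self_of_nhds.trans (congrArg _ hcz)
  -- the derivatives of the components of `V` cancel, whatever the extension `V`
  rw [hVX, add_sub_right_comm, ← map_sub]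
  simp

end AnisotropicConnection
end PseudoFinsler

/-! ### The orthogonal projection to the kernel of a surjective linear map -/

namespace PseudoFinsler.Model

variable {E F : Type*} [NormedAddCommGroup E] [NormedSpace ℝ E] [NormedAddCommGroup F]
  [NormedSpace ℝ F] (g : E →L[ℝ] E →L[ℝ] ℝ) (S : E →L[ℝ] F)

/-- The operator `(w, l) ↦ (g(w, ·) + l ∘ S, S w)` of the saddle point problem whose solution is the
`g`-orthogonal projection to the kernel of `S`, `l` being the Lagrange multiplier. -/
noncomputable def saddle : E × (F →L[ℝ] ℝ) →L[ℝ] (E →L[ℝ] ℝ) × F :=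
  ContinuousLinearMap.inl ℝ _ _ ∘L (g ∘L ContinuousLinearMap.fst ℝ _ _ +
      (ContinuousLinearMap.compL ℝ E F ℝ).flip S ∘L ContinuousLinearMap.snd ℝ _ _) +
    ContinuousLinearMap.inr ℝ _ _ ∘L (S ∘L ContinuousLinearMap.fst ℝ _ _)

/-- The `g`-orthogonal projection to the kernel of `S`. -/
noncomputable def kerProj : E →L[ℝ] E :=
  ContinuousLinearMap.fst ℝ _ _ ∘L (saddle g S).inverse ∘L ContinuousLinearMap.inl ℝ _ _ ∘L g

variable {g S}

lemma saddle_apply (w : E) (l : F →L[ℝ] ℝ) : saddle g S (w, l) = (g w + l ∘L S, S w) := by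
  ext <;> simp [saddle]

lemma finrank_continuousDual (V : Type*) [NormedAddCommGroup V] [NormedSpace ℝ V]
    [FiniteDimensional ℝ V] : Module.finrank ℝ (V →L[ℝ] ℝ) = Module.finrank ℝ V :=
  (LinearMap.toContinuousLinearMap : (V →ₗ[ℝ] ℝ) ≃ₗ[ℝ] (V →L[ℝ] ℝ)).finrank_eq.symm.trans
    Subspace.dual_finrank_eq

/-- On the kernel of the saddle operator, `w` lies in `ker S` and is `g`-orthogonal to it, hence
vanishes; then `l ∘ S` vanishes, hence `l`. -/
lemma isInvertible_saddle [FiniteDimensional ℝ E] [FiniteDimensional ℝ F]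
    (hS : Function.Surjective S)
    (hg : ∀ w, S w = 0 → (∀ u, S u = 0 → g w u = 0) → w = 0) : (saddle g S).IsInvertible := by
  have hinj : Function.Injective (saddle g S).toLinearMap := by
    rw [← LinearMap.ker_eq_bot, LinearMap.ker_eq_bot']
    rintro ⟨w, l⟩ h
    have h : saddle g S (w, l) = 0 := h
    rw [saddle_apply, Prod.mk_eq_zero] at h
    have hw : w = 0 := by
      refine hg w h.2 fun u hu => ?_
      simpa [hu] using congr($(h.1) u)
    have hl : l = 0 := by
      ext y
      obtain ⟨u, rfl⟩ := hS y
      simpa [hw] using congr($(h.1) u)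
    rw [hw, hl, Prod.mk_zero_zero]
  have hrank : Module.finrank ℝ (E × (F →L[ℝ] ℝ)) = Module.finrank ℝ ((E →L[ℝ] ℝ) × F) := by
    rw [Module.finrank_prod, Module.finrank_prod, finrank_continuousDual, finrank_continuousDual]
  exact ⟨(LinearEquiv.ofInjectiveOfFinrankEq (saddle g S).toLinearMap hinj
    hrank).toContinuousLinearEquiv, ContinuousLinearMap.ext fun _ => rfl⟩

lemma kerProj_mem (h : (saddle g S).IsInvertible) (e : E) : S (kerProj g S e) = 0 := by
  rcases hwl : (saddle g S).inverse (g e, 0) with ⟨w, l⟩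
  have h2 : saddle g S (w, l) = (g e, 0) := by rw [← hwl, h.self_apply_inverse]
  rw [saddle_apply, Prod.mk_inj] at h2
  simp [kerProj, hwl, h2.2]

lemma kerProj_orthogonal (h : (saddle g S).IsInvertible) (e : E) {u : E} (hu : S u = 0) :
    g (e - kerProj g S e) u = 0 := by
  rcases hwl : (saddle g S).inverse (g e, 0) with ⟨w, l⟩
  have h2 : saddle g S (w, l) = (g e, 0) := by rw [← hwl, h.self_apply_inverse]
  rw [saddle_apply, Prod.mk_inj] at h2
  have hk : kerProj g S e = w := by simp [kerProj, hwl]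
  rw [hk, map_sub, ← h2.1]
  simp [hu]

lemma kerProj_of_mem (h : (saddle g S).IsInvertible) {e : E} (he : S e = 0) :
    kerProj g S e = e := by
  have h2 : (saddle g S).inverse (g e, 0) = (e, 0) := by
    have : (g e, (0 : F)) = saddle g S (e, 0) := by simp [saddle_apply, he]
    rw [this, h.inverse_apply_self]
  simp [kerProj, h2]

set_option synthInstance.maxHeartbeats 200000 in
lemma contDiffAt_kerProj [FiniteDimensional ℝ E] [FiniteDimensional ℝ F] {V : Type*}
    [NormedAddCommGroup V] [NormedSpace ℝ V] {n : ℕ∞ω}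
    {g : V → E →L[ℝ] E →L[ℝ] ℝ} {S : V → E →L[ℝ] F} {z : V} (hg : ContDiffAt ℝ n g z)
    (hS : ContDiffAt ℝ n S z) (h : (saddle (g z) (S z)).IsInvertible) :
    ContDiffAt ℝ n (fun z => kerProj (g z) (S z)) z := by
  have : CompleteSpace (E × (F →L[ℝ] ℝ)) := FiniteDimensional.complete ℝ _
  have h1 : ContDiffAt ℝ n (fun z => saddle (g z) (S z)) z := by
    refine (contDiffAt_const.clm_comp ((hg.clm_comp contDiffAt_const).add
      (ContDiffAt.clm_comp ?_ contDiffAt_const))).add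
      (contDiffAt_const.clm_comp (hS.clm_comp contDiffAt_const))
    exact (ContinuousLinearMap.contDiff (E := E →L[ℝ] F) (F := (F →L[ℝ] ℝ) →L[ℝ] (E →L[ℝ] ℝ))
      (ContinuousLinearMap.compL ℝ E F ℝ).flip).contDiffAt.comp z hS
  obtain ⟨e, he⟩ := h
  have h2 : ContDiffAt ℝ n (fun z => (saddle (g z) (S z)).inverse) z := by
    refine ContDiffAt.comp (g := ContinuousLinearMap.inverse) z ?_ h1
    rw [← he]
    exact contDiffAt_map_inverse e
  exact contDiffAt_const.clm_comp (h2.clm_comp (contDiffAt_const.clm_comp hg))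

lemma deriv_deriv_line {V : Type*} [NormedAddCommGroup V] [NormedSpace ℝ V] {f : V → ℝ} {z : V}
    (hf : ContDiffAt ℝ 2 f z) (a b : V) :
    deriv (fun s : ℝ => deriv (fun t : ℝ => f (z + s • a + t • b)) 0) 0 =
      fderiv ℝ (fderiv ℝ f) z a b := by
  have hline (x c : V) : HasDerivAt (fun t : ℝ => x + t • c) c 0 := by
    simpa using ((hasDerivAt_id (0 : ℝ)).smul_const c).const_add x
  have hev : (fun s : ℝ => deriv (fun t : ℝ => f (z + s • a + t • b)) 0) =ᶠ[𝓝 0]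
      fun s => fderiv ℝ f (z + s • a) b := by
    have hcont : Tendsto (fun s : ℝ => z + s • a) (𝓝 0) (𝓝 z) := by
      simpa using (hline z a).continuousAt.tendsto
    filter_upwards [hcont.eventually (hf.eventually (by simp))] with s hs
    have h1 : HasFDerivAt f (fderiv ℝ f (z + s • a)) (z + s • a + (0 : ℝ) • b) := by
      simpa using (hs.differentiableAt two_ne_zero).hasFDerivAt
    exact (h1.comp_hasDerivAt 0 (hline _ b)).deriv
  have h2 : HasFDerivAt (fderiv ℝ f) (fderiv ℝ (fderiv ℝ f) z) (z + (0 : ℝ) • a) := by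
    simpa using ((hf.fderiv_right (m := 1) (by norm_num)).differentiableAt one_ne_zero).hasFDerivAt
  rw [hev.deriv_eq]
  have h3 : HasDerivAt (fun s : ℝ => fderiv ℝ f (z + s • a)) (fderiv ℝ (fderiv ℝ f) z a) 0 :=
    h2.comp_hasDerivAt 0 (hline z a)
  exact ((ContinuousLinearMap.apply ℝ ℝ b).hasFDerivAt.comp_hasDerivAt 0 h3).deriv

end PseudoFinsler.Model

/-! ### Pseudo-Finsler submersions in coordinates -/

namespace PseudoFinsler

open Model

variable {E : Type*} [NormedAddCommGroup E] [NormedSpace ℝ E]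
  {M : Type*} [TopologicalSpace M] [ChartedSpace E M] [IsManifold 𝓘(ℝ, E) ∞ M]
  {F : Type*} [NormedAddCommGroup F] [NormedSpace ℝ F]
  {B : Type*} [TopologicalSpace B] [ChartedSpace F B] [IsManifold 𝓘(ℝ, F) ∞ B]
  (m : Metric E M) (σ : M → B) {p : M} {z : E × E}

/-- The fundamental tensor in coordinates. -/
noncomputable def gram (p : M) (z : E × E) : E →L[ℝ] E →L[ℝ] ℝ :=
  (1 / 2 : ℝ) • ((ContinuousLinearMap.compL ℝ E (E × E) ℝ).flip (ContinuousLinearMap.inr ℝ E E) ∘L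
    fderiv ℝ (fderiv ℝ fun z => m.L (lift p z)) z ∘L ContinuousLinearMap.inr ℝ E E)

/-- The differential of `σ : M → B` in the preferred charts at `p` and at `σ p`. -/
noncomputable def diffInCharts (p : M) (z : E × E) : E →L[ℝ] F :=
  fderiv ℝ (extChartAt 𝓘(ℝ, F) (σ p) ∘ σ ∘ (extChartAt 𝓘(ℝ, E) p).symm) z.1

variable (F) in
/-- The projection to the vertical space in coordinates. -/
noncomputable def vproj (p : M) (z : E × E) : E →L[ℝ] E :=
  kerProj (gram m p z) (diffInCharts σ p z : E →L[ℝ] F)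

variable (F) in
/-- The admissible vectors whose base point is mapped by `σ` to the preferred chart at `σ p`. -/
def admOver (p : M) : Set (TM E M) := {v | v ∈ m.adm ∧ σ v.1 ∈ (chartAt F (σ p)).source}

variable {m σ}

omit [IsManifold 𝓘(ℝ, F) ∞ B] [NormedSpace ℝ F] in
lemma isOpen_admOver (hσ : Continuous σ) : IsOpen (admOver F m σ p : Set (TM E M)) :=
  m.isOpen_adm.inter ((chartAt F (σ p)).open_source.preimage
    (hσ.comp (FiberBundle.continuous_proj E (TangentSpace 𝓘(ℝ, E)))))

lemma contDiffAt_L (hz : z ∈ coordDomain p m.adm) :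
    ContDiffAt ℝ ∞ (fun z => m.L (lift p z)) z := by
  rw [← contMDiffAt_iff_contDiffAt]
  exact (m.smooth.contMDiffAt (m.isOpen_adm.mem_nhds hz.2)).comp z (contMDiffAt_lift hz.1)

lemma contDiffAt_gram (hz : z ∈ coordDomain p m.adm) : ContDiffAt ℝ ∞ (gram m p) z := by
  have h1 : ContDiffAt ℝ ∞ (fderiv ℝ (fderiv ℝ fun z => m.L (lift p z))) z :=
    ((contDiffAt_L hz).fderiv_right (m := ∞) le_rfl).fderiv_right le_rfl
  exact ((contDiffAt_const (c := (ContinuousLinearMap.compL ℝ E (E × E) ℝ).flip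
    (ContinuousLinearMap.inr ℝ E E))).clm_comp (h1.clm_comp
      (contDiffAt_const (c := ContinuousLinearMap.inr ℝ E E)))).const_smul (1 / 2 : ℝ)

/-- The iterated derivative defining `g` is a second derivative of `L` in coordinates. -/
lemma g_eq_gram (hz : z ∈ coordDomain p m.adm) (e h : TangentSpace 𝓘(ℝ, E) (lift p z).1) :
    m.g (lift p z) e h = gram m p z (comps p _ e) (comps p _ h) := by
  have hfib (s t : ℝ) : m.L (vadd (lift p z) (s • e + t • h)) = m.L (lift p
      (z + s • ((0 : E), comps p _ e) + t • ((0 : E), comps p _ h))) := by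
    rw [lift_add _ _ hz.1]
    congr 2
    ext <;> simp [add_assoc]
  simp only [Metric.g, fundamentalTensor, hfib]
  rw [deriv_deriv_line (f := fun z => m.L (lift p z))
    ((contDiffAt_L hz).of_le (WithTop.coe_le_coe.2 le_top))]
  rfl

lemma contDiffAt_inCharts (hσ : ContMDiff 𝓘(ℝ, E) 𝓘(ℝ, F) ∞ σ)
    (hz : z ∈ coordDomain p (admOver F m σ p)) :
    ContDiffAt ℝ ∞ (extChartAt 𝓘(ℝ, F) (σ p) ∘ σ ∘ (extChartAt 𝓘(ℝ, E) p).symm) z.1 := by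
  rw [← contMDiffAt_iff_contDiffAt]
  refine ContMDiffAt.comp z.1 (contMDiffAt_extChartAt' hz.2.2) ?_
  exact (hσ _).comp z.1 ((contMDiffOn_extChartAt_symm p).contMDiffAt
    ((isOpen_extChartAt_target p).mem_nhds hz.1))

lemma contDiffAt_diffInCharts (hσ : ContMDiff 𝓘(ℝ, E) 𝓘(ℝ, F) ∞ σ)
    (hz : z ∈ coordDomain p (admOver F m σ p)) :
    ContDiffAt ℝ ∞ (diffInCharts σ p : E × E → E →L[ℝ] F) z :=
  ((contDiffAt_inCharts hσ hz).fderiv_right (m := ∞) le_rfl).comp z contDiffAt_fst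

lemma diffInCharts_comps (hσ : ContMDiff 𝓘(ℝ, E) 𝓘(ℝ, F) ∞ σ)
    (hz : z ∈ coordDomain p (admOver F m σ p)) (e : TangentSpace 𝓘(ℝ, E) (lift p z).1) :
    diffInCharts σ p z (comps p _ e) =
      comps (σ p) _ (mfderiv 𝓘(ℝ, E) 𝓘(ℝ, F) σ (lift p z).1 e) := by
  have hp := lift_fst_mem hz.1
  have hq : extChartAt 𝓘(ℝ, E) p (lift p z).1 = z.1 := (extChartAt 𝓘(ℝ, E) p).right_inv hz.1
  have hs : DifferentiableAt ℝ (extChartAt 𝓘(ℝ, F) (σ p) ∘ σ ∘ (extChartAt 𝓘(ℝ, E) p).symm)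
      (extChartAt 𝓘(ℝ, E) p (lift p z).1) := by
    rw [hq]
    exact (contDiffAt_inCharts hσ hz).differentiableAt (by simp)
  have h1 := hs.hasFDerivAt.hasMFDerivAt.comp _
    (mdifferentiableAt_extChartAt (I := 𝓘(ℝ, E)) hp).hasMFDerivAt
  have h2 := (mdifferentiableAt_extChartAt (I := 𝓘(ℝ, F)) hz.2.2).hasMFDerivAt.comp _
    ((hσ (lift p z).1).mdifferentiableAt (by simp)).hasMFDerivAt
  have hev : extChartAt 𝓘(ℝ, F) (σ p) ∘ σ =ᶠ[𝓝 (lift p z).1]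
      (extChartAt 𝓘(ℝ, F) (σ p) ∘ σ ∘ (extChartAt 𝓘(ℝ, E) p).symm) ∘ extChartAt 𝓘(ℝ, E) p := by
    filter_upwards [eventually_mem_source hp] with x hx
    have : (extChartAt 𝓘(ℝ, E) p).symm (extChartAt 𝓘(ℝ, E) p x) = x :=
      (extChartAt 𝓘(ℝ, E) p).left_inv (by simpa using hx)
    simp only [Function.comp_apply, this]
  have h3 := hasMFDerivAt_unique (h1.congr_of_eventuallyEq hev) h2
  rw [hq] at h3
  rw [comps_eq_mvfderiv hp, comps_eq_mvfderiv hz.2.2]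
  exact congr($h3 e)

lemma mem_vertical_iff (hσ : ContMDiff 𝓘(ℝ, E) 𝓘(ℝ, F) ∞ σ)
    (hz : z ∈ coordDomain p (admOver F m σ p)) (e : TangentSpace 𝓘(ℝ, E) (lift p z).1) :
    e ∈ vertical E F σ (lift p z).1 ↔ diffInCharts σ p z (comps p _ e) = (0 : F) := by
  rw [diffInCharts_comps hσ hz]
  refine Iff.trans ?_ (map_eq_zero_iff _ (comps_injective hz.2.2)).symm
  rfl

variable [FiniteDimensional ℝ E] [FiniteDimensional ℝ F]

lemma isInvertible_saddle_gram (hσ : ContMDiff 𝓘(ℝ, E) 𝓘(ℝ, F) ∞ σ)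
    (hsurj : ∀ p, Function.Surjective (mfderiv 𝓘(ℝ, E) 𝓘(ℝ, F) σ p))
    (hvert : ∀ v ∈ m.adm, m.VerticalNondegenerate F σ v)
    (hz : z ∈ coordDomain p (admOver F m σ p)) :
    (saddle (gram m p z) (diffInCharts σ p z : E →L[ℝ] F)).IsInvertible := by
  have hz' : z ∈ coordDomain p m.adm := ⟨hz.1, hz.2.1⟩
  have hp := lift_fst_mem hz.1
  apply isInvertible_saddle
  · intro y
    obtain ⟨e, he⟩ := hsurj (lift p z).1 (frame (σ p) _ y)
    refine ⟨comps p _ e, ?_⟩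
    rw [diffInCharts_comps hσ hz, he]
    exact comps_frame hz.2.2 y
  · intro w hw h
    have := hvert _ hz.2.1 (frame p _ w) ?_ ?_
    · rw [← comps_frame hp w, this, map_zero]
    · rwa [mem_vertical_iff hσ hz, comps_frame hp]
    · intro u hu
      rw [mem_vertical_iff hσ hz] at hu
      rw [g_eq_gram hz', comps_frame hp]
      exact h _ hu

/-- The vertical part is unique, hence given by the projection built from the saddle operator. -/
lemma comps_vpart (hσ : ContMDiff 𝓘(ℝ, E) 𝓘(ℝ, F) ∞ σ)
    (hsurj : ∀ p, Function.Surjective (mfderiv 𝓘(ℝ, E) 𝓘(ℝ, F) σ p))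
    (hvert : ∀ v ∈ m.adm, m.VerticalNondegenerate F σ v)
    (hz : z ∈ coordDomain p (admOver F m σ p)) (e : TangentSpace 𝓘(ℝ, E) (lift p z).1) :
    comps p _ (vpart F m σ (lift p z) e) = vproj F m σ p z (comps p _ e) := by
  have hz' : z ∈ coordDomain p m.adm := ⟨hz.1, hz.2.1⟩
  have hp := lift_fst_mem hz.1
  have hinv := isInvertible_saddle_gram hσ hsurj hvert hz
  have hw : frame p _ (vproj F m σ p z (comps p _ e)) ∈ vertical E F σ (lift p z).1 := by
    rw [mem_vertical_iff hσ hz, comps_frame hp]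
    exact kerProj_mem hinv _
  have hex : ∃ w ∈ vertical E F σ (lift p z).1, ∀ u ∈ vertical E F σ (lift p z).1,
      m.g (lift p z) (e - w) u = 0 := by
    refine ⟨_, hw, fun u hu => ?_⟩
    rw [mem_vertical_iff hσ hz] at hu
    rw [g_eq_gram hz', map_sub, comps_frame hp]
    exact kerProj_orthogonal hinv _ hu
  have hv := hex.choose_spec
  rw [vpart, dif_pos hex]
  set w := hex.choose
  have := hvert _ hz.2.1 (w - frame p _ (vproj F m σ p z (comps p _ e)))
    (Submodule.sub_mem _ hv.1 hw) fun u hu => ?_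
  · rw [sub_eq_zero] at this
    rw [this, comps_frame hp]
  · have h1 := hv.2 u hu
    rw [mem_vertical_iff hσ hz] at hu
    have h2 := kerProj_orthogonal hinv (comps p _ e) hu
    rw [g_eq_gram hz', map_sub] at h1 ⊢
    rw [comps_frame hp]
    simp only [map_sub, sub_apply, vproj] at h1 h2 ⊢
    linarith

lemma contDiffAt_vproj (hσ : ContMDiff 𝓘(ℝ, E) 𝓘(ℝ, F) ∞ σ)
    (hsurj : ∀ p, Function.Surjective (mfderiv 𝓘(ℝ, E) 𝓘(ℝ, F) σ p))
    (hvert : ∀ v ∈ m.adm, m.VerticalNondegenerate F σ v)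
    (hz : z ∈ coordDomain p (admOver F m σ p)) : ContDiffAt ℝ ∞ (vproj F m σ p) z :=
  contDiffAt_kerProj (contDiffAt_gram ⟨hz.1, hz.2.1⟩) (contDiffAt_diffInCharts hσ hz)
    (isInvertible_saddle_gram hσ hsurj hvert hz)

lemma vproj_vproj (hσ : ContMDiff 𝓘(ℝ, E) 𝓘(ℝ, F) ∞ σ)
    (hsurj : ∀ p, Function.Surjective (mfderiv 𝓘(ℝ, E) 𝓘(ℝ, F) σ p))
    (hvert : ∀ v ∈ m.adm, m.VerticalNondegenerate F σ v)
    (hz : z ∈ coordDomain p (admOver F m σ p)) (w : E) :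
    vproj F m σ p z (vproj F m σ p z w) = vproj F m σ p z w :=
  have hinv := isInvertible_saddle_gram hσ hsurj hvert hz
  kerProj_of_mem hinv (kerProj_mem hinv w)

end PseudoFinsler

/-! ### The fundamental equation -/

namespace PseudoFinsler

open Model AnisotropicConnection

variable {E : Type*} [NormedAddCommGroup E] [NormedSpace ℝ E] [FiniteDimensional ℝ E]
  {M : Type*} [TopologicalSpace M] [ChartedSpace E M] [IsManifold 𝓘(ℝ, E) ∞ M]
  {F : Type*} [NormedAddCommGroup F] [NormedSpace ℝ F] [FiniteDimensional ℝ F]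
  {B : Type*} [TopologicalSpace B] [ChartedSpace F B] [IsManifold 𝓘(ℝ, F) ∞ B]
  {m : Metric E M} {m' : Metric F B} {σ : M → B} {p : M} {z : E × E}

section

variable {A : Set (TM E M)} {D : AnisotropicConnection E M A}

omit [FiniteDimensional ℝ E] in
lemma covField_iso (H : VField E M) (u : TM E M) (e : TangentSpace 𝓘(ℝ, E) u.1) :
    D.covField (iso H) u e = D.cov u H e := by
  -- `iso H` is constant on the fibres
  have h : fiberDeriv (iso H) u (D.cov u (ext u.2) e) = 0 :=
    deriv_const (F := E) (0 : ℝ) (H u.1)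
  rw [covField, h, sub_zero]
  rfl

lemma rep_nabla (hz : z ∈ coordDomain p A) {X : AnisotropicField E M}
    (hX : DifferentiableAt ℝ (rep p X) z) (Y : VField E M) :
    rep p (D.nabla Y X) z = nab (D.christoffel p) (rep p X) z (rep p (iso Y) z) :=
  comps_covField hz hX _

omit [FiniteDimensional ℝ E] in
lemma differentiableAt_rep_ext (hz : z.1 ∈ (extChartAt 𝓘(ℝ, E) p).target)
    (e : TangentSpace 𝓘(ℝ, E) (lift p z).1) : DifferentiableAt ℝ (rep p (iso (ext e))) z :=
  (contDiffAt_rep_of_contMDiffAt (n := 1) (by simp) hz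
    (FiberBundle.contMDiffAt_extend 𝓘(ℝ, E) E e)).differentiableAt one_ne_zero

omit [FiniteDimensional ℝ E] in
lemma rep_ext (e : TangentSpace 𝓘(ℝ, E) (lift p z).1) : rep p (iso (ext e)) z = comps p _ e :=
  congrArg (comps p _) (FiberBundle.extend_apply_self E e)

/-- The covariant derivative of an anisotropic tensor of type `(1,2)` in coordinates. -/
lemma comps_covTensor (hz : z ∈ coordDomain p A) {Ξ : AnisotropicTensor E M}
    {K : E × E → E →L[ℝ] E →L[ℝ] E} (hK : DifferentiableAt ℝ K z)
    (hΞ : ∀ᶠ z in 𝓝 z, ∀ b e, comps p _ (Ξ (lift p z) b e) = K z (comps p _ b) (comps p _ e))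
    (e h b : TangentSpace 𝓘(ℝ, E) (lift p z).1) :
    comps p _ (D.covTensor Ξ (lift p z) e h b) =
      nabTensor (D.christoffel p) K z (comps p _ e) (comps p _ h) (comps p _ b) := by
  have hh := differentiableAt_rep_ext hz.1 h
  have hb := differentiableAt_rep_ext hz.1 b
  have hrep : rep p (fun u => Ξ u (ext h u.1) (ext b u.1)) =ᶠ[𝓝 z]
      fun z => K z (rep p (iso (ext h)) z) (rep p (iso (ext b)) z) :=
    hΞ.mono fun z hz => hz _ _
  have hd : DifferentiableAt ℝ (rep p (fun u => Ξ u (ext h u.1) (ext b u.1))) z :=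
    ((hK.clm_apply hh).clm_apply hb).congr_of_eventuallyEq hrep
  have hΞz := hΞ.self_of_nhds
  rw [covTensor, map_sub, map_sub, comps_covField hz hd, nab_congr hrep,
    nab_bilin_apply hK hh hb, hΞz, hΞz, ← covField_iso, ← covField_iso, comps_covField hz hh,
    comps_covField hz hb, rep_ext, rep_ext]
  abel

lemma comps_curvature (hA : IsOpen A) (hz : z ∈ coordDomain p A) {X Y Z : VField E M}
    [T2Space M]
    (hX : ContDiffAt ℝ 1 (rep p (iso X)) z) (hY : ContDiffAt ℝ 1 (rep p (iso Y)) z)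
    (hZ : ContDiffAt ℝ 2 (rep p (iso Z)) z) :
    comps p _ (D.curvature X Y Z (lift p z)) =
      nab (D.christoffel p) (fun z => nab (D.christoffel p) (rep p (iso Z)) z (rep p (iso Y) z)) z
          (rep p (iso X) z)
        - nab (D.christoffel p) (fun z => nab (D.christoffel p) (rep p (iso Z)) z
          (rep p (iso X) z)) z (rep p (iso Y) z)
        - nab (D.christoffel p) (rep p (iso Z)) z
          (comps p _ (VectorField.mlieBracket 𝓘(ℝ, E) X Y (lift p z).1)) := by
  have hopen := (isOpen_coordDomain (p := p) hA).mem_nhds hz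
  have hG : ContDiffAt ℝ 1 (D.christoffel p) z :=
    ((contDiffOn_christoffel hA).contDiffAt hopen).of_le (by simp)
  have hev (Y : VField E M) : rep p (fun u => D.cov u Z (Y u.1)) =ᶠ[𝓝 z]
      fun z => nab (D.christoffel p) (rep p (iso Z)) z (rep p (iso Y) z) := by
    filter_upwards [hopen, hZ.eventually (by simp)] with z hz hZ
    rw [← rep_nabla hz (hZ.differentiableAt two_ne_zero)]
    simp only [rep, nabla, covField_iso]
  have hd {Y : VField E M} (hY : ContDiffAt ℝ 1 (rep p (iso Y)) z) :
      DifferentiableAt ℝ (rep p (fun u => D.cov u Z (Y u.1))) z :=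
    ((contDiffAt_nab hG hZ hY).differentiableAt one_ne_zero).congr_of_eventuallyEq (hev Y)
  rw [curvature, map_sub, map_sub, comps_covField hz (hd hY), comps_covField hz (hd hX),
    nab_congr (hev Y), nab_congr (hev X), ← covField_iso, comps_covField hz
      (hZ.differentiableAt two_ne_zero)]
  rfl

/-- The curvature of a projected connection in coordinates, where the projection `S` of anisotropic
vector fields is given by a field `Q` of linear maps in coordinates. -/
lemma rep_projCurvature [T2Space M] (hA : IsOpen A) (hz : z ∈ coordDomain p A)
    {S : AnisotropicField E M → AnisotropicField E M} {Q : E × E → E →L[ℝ] E}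
    (hQ : ContDiffAt ℝ 2 Q z) (hS : ∀ᶠ z in 𝓝 z, ∀ X, rep p (S X) z = Q z (rep p X z))
    {X Y Z : VField E M} (hX : ContDiffAt ℝ 1 (rep p (iso X)) z)
    (hY : ContDiffAt ℝ 1 (rep p (iso Y)) z) (hZ : ContDiffAt ℝ 2 (rep p (iso Z)) z) :
    rep p (S fun u => D.covField (S (D.nabla Y (S (iso Z)))) u (X u.1)
      - D.covField (S (D.nabla X (S (iso Z)))) u (Y u.1)
      - D.covField (S (iso Z)) u (VectorField.mlieBracket 𝓘(ℝ, E) X Y u.1)) z =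
    projCurvature (D.christoffel p) Q (rep p (iso X)) (rep p (iso Y)) (rep p (iso Z))
      (comps p _ (VectorField.mlieBracket 𝓘(ℝ, E) X Y (lift p z).1)) z := by
  have hopen := (isOpen_coordDomain (p := p) hA).mem_nhds hz
  have hG : ContDiffAt ℝ 1 (D.christoffel p) z :=
    ((contDiffOn_christoffel hA).contDiffAt hopen).of_le (by simp)
  have hf : ContDiffAt ℝ 2 (fun z => Q z (rep p (iso Z) z)) z := hQ.clm_apply hZ
  have h1 : rep p (S (iso Z)) =ᶠ[𝓝 z] fun z => Q z (rep p (iso Z) z) := hS.mono fun z h => h _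
  have h2 (W : VField E M) : rep p (S (D.nabla W (S (iso Z)))) =ᶠ[𝓝 z] fun z =>
      Q z (nab (D.christoffel p) (fun z => Q z (rep p (iso Z) z)) z (rep p (iso W) z)) := by
    filter_upwards [hopen, hS, h1.eventuallyEq_nhds, hf.eventually (by simp)] with z hz hS h1 h2
    rw [hS, rep_nabla hz ((h2.differentiableAt two_ne_zero).congr_of_eventuallyEq h1),
      nab_congr h1]
  have hd {W : VField E M} (hW : ContDiffAt ℝ 1 (rep p (iso W)) z) :=
    (((hQ.of_le one_le_two).clm_apply (contDiffAt_nab hG hf hW)).differentiableAt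
      one_ne_zero).congr_of_eventuallyEq (h2 W)
  rw [hS.self_of_nhds, rep, map_sub (comps p _), map_sub (comps p _), comps_covField hz (hd hY),
    comps_covField hz (hd hX),
    comps_covField hz ((hf.differentiableAt two_ne_zero).congr_of_eventuallyEq h1),
    nab_congr (h2 Y), nab_congr (h2 X), nab_congr h1]
  rfl

end

variable (hσ : IsSubmersion m m' σ) (hvert : ∀ v ∈ m.adm, m.VerticalNondegenerate F σ v)
  {D : AnisotropicConnection E M m.adm}
include hσ hvert

lemma rep_top (hz : z ∈ coordDomain p (admOver F m σ p)) (X : AnisotropicField E M) :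
    rep p (top F m σ X) z = vproj F m σ p z (rep p X z) :=
  comps_vpart hσ.smooth hσ.surjective_mfderiv hvert hz _

lemma rep_bot (hz : z ∈ coordDomain p (admOver F m σ p)) (X : AnisotropicField E M) :
    rep p (bot F m σ X) z = rep p X z - vproj F m σ p z (rep p X z) := by
  rw [← rep_top hσ hvert hz]
  exact map_sub _ _ _

/-- In coordinates, `χ` is the difference of `∇` and the projected connections. As both sides are
tensorial, the chart used for the extension in the definition of `χ` does not matter. -/
lemma comps_chi (hz : z ∈ coordDomain p (admOver F m σ p))
    (b e : TangentSpace 𝓘(ℝ, E) (lift p z).1) :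
    comps p _ (chi F m σ D (lift p z) b e) =
      diffTensor (D.christoffel p) (vproj F m σ p) z (comps p _ b) (comps p _ e) := by
  have hz' : z ∈ coordDomain p m.adm := ⟨hz.1, hz.2.1⟩
  have hopen := (isOpen_coordDomain (isOpen_admOver (m := m) hσ.smooth.continuous)).mem_nhds hz
  have hP : DifferentiableAt ℝ (vproj F m σ p) z :=
    (contDiffAt_vproj hσ.smooth hσ.surjective_mfderiv hvert hz).differentiableAt (by simp)
  have he := differentiableAt_rep_ext hz.1 e
  have htop : rep p (top F m σ (iso (ext e))) =ᶠ[𝓝 z] fun z => vproj F m σ p z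
      (rep p (iso (ext e)) z) := by
    filter_upwards [hopen] with z hz using rep_top hσ hvert hz _
  have hbot : rep p (bot F m σ (iso (ext e))) =ᶠ[𝓝 z] fun z => rep p (iso (ext e)) z -
      vproj F m σ p z (rep p (iso (ext e)) z) := by
    filter_upwards [hopen] with z hz using rep_bot hσ hvert hz _
  have hdtop := (hP.clm_apply he).congr_of_eventuallyEq htop
  have hdbot := (he.sub (hP.clm_apply he)).congr_of_eventuallyEq hbot
  rw [← rep_ext e, ← diffTensor_apply_eq hP
    (vproj_vproj hσ.smooth hσ.surjective_mfderiv hvert hz) he, chi, map_add, hpart, map_sub,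
    comps_vpart hσ.smooth hσ.surjective_mfderiv hvert hz,
    comps_vpart hσ.smooth hσ.surjective_mfderiv hvert hz, comps_covField hz' hdtop,
    comps_covField hz' hdbot, nab_congr htop, nab_congr hbot]

lemma comps_tensorT_add_tensorA (hz : z ∈ coordDomain p (admOver F m σ p))
    (b e : TangentSpace 𝓘(ℝ, E) (lift p z).1) :
    comps p _ ((tensorT F m σ D + tensorA F m σ D) (lift p z) b e) =
      diffTensor (D.christoffel p) (vproj F m σ p) z (comps p _ b) (comps p _ e) := by
  -- `T^v_b e + A^v_b e = χ^v_{b^⊤} e + χ^v_{b^⊥} e` by definition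
  change comps p _ (chi F m σ D (lift p z) _ e + chi F m σ D (lift p z) (_ - _) e) = _
  rw [map_add, comps_chi hσ hvert hz, comps_chi hσ hvert hz, ← add_apply, ← map_add, ← map_add,
    add_sub_cancel]

end PseudoFinsler

open PseudoFinsler in
theorem mainTheorem1
    {E : Type*} [NormedAddCommGroup E] [NormedSpace ℝ E] [FiniteDimensional ℝ E]
    {M : Type*} [TopologicalSpace M] [T2Space M] [ChartedSpace E M] [IsManifold 𝓘(ℝ, E) ∞ M]
    {F : Type*} [NormedAddCommGroup F] [NormedSpace ℝ F] [FiniteDimensional ℝ F]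
    {B : Type*} [TopologicalSpace B] [T2Space B] [ChartedSpace F B] [IsManifold 𝓘(ℝ, F) ∞ B]
    (m : Metric E M) (m' : Metric F B) (σ : M → B)
    (hσ : IsSubmersion m m' σ)
    (hvert : ∀ v ∈ m.adm, m.VerticalNondegenerate F σ v)
    (D : AnisotropicConnection E M m.adm) (hD : m.IsChernConnection D)
    (v : TM E M) (hv : v ∈ m.adm) (e h b : TangentSpace 𝓘(ℝ, E) v.1)
    (X Y Z : VField E M) (hX : IsLocalExtension e X) (hY : IsLocalExtension h Y)
    (hZ : IsLocalExtension b Z) :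
    D.curvature X Y Z v =
      curvatureTop F m σ D X Y Z v + curvatureBot F m σ D X Y Z v
      + D.covTensor (tensorT F m σ D + tensorA F m σ D) v e h b
      - D.covTensor (tensorT F m σ D + tensorA F m σ D) v h e b
      + (tensorT F m σ D + tensorA F m σ D) v h ((tensorT F m σ D + tensorA F m σ D) v e b)
      - (tensorT F m σ D + tensorA F m σ D) v e ((tensorT F m σ D + tensorA F m σ D) v h b) := by
  obtain ⟨p, z, hz1, hpz, rfl⟩ := exists_lift_eq v
  have hz : z ∈ coordDomain p (admOver F m σ p) :=
    ⟨hz1, hv, by rw [← hpz]; exact mem_chart_source F _⟩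
  have hz' : z ∈ coordDomain p m.adm := ⟨hz1, hv⟩
  have hopen := (isOpen_coordDomain (isOpen_admOver (m := m) hσ.smooth.continuous)).mem_nhds hz
  have hsm {W : VField E M} {w : TangentSpace 𝓘(ℝ, E) (lift p z).1} (hW : IsLocalExtension w W) :
      ContDiffAt ℝ ∞ (rep p (iso W)) z :=
    contDiffAt_rep_of_contMDiffAt le_rfl hz1 hW.2.self_of_nhds
  have h1 : (1 : ℕ∞ω) ≤ ∞ := by simp
  have h2 : (2 : ℕ∞ω) ≤ ∞ := WithTop.coe_le_coe.2 le_top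
  have hX1 := (hsm hX).of_le h1
  have hY1 := (hsm hY).of_le h1
  have hZ2 := (hsm hZ).of_le h2
  have hG : ContDiffAt ℝ 1 (D.christoffel p) z :=
    ((AnisotropicConnection.contDiffOn_christoffel m.isOpen_adm).contDiffAt
      ((isOpen_coordDomain m.isOpen_adm).mem_nhds hz')).of_le h1
  have hP : ContDiffAt ℝ 2 (vproj F m σ p) z :=
    (contDiffAt_vproj hσ.smooth hσ.surjective_mfderiv hvert hz).of_le h2
  have hPP : ∀ᶠ z in 𝓝 z, ∀ w, vproj F m σ p z (vproj F m σ p z w) = vproj F m σ p z w := by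
    filter_upwards [hopen] with z hz
      using vproj_vproj hσ.smooth hσ.surjective_mfderiv hvert hz
  have hK := (Model.contDiffAt_diffTensor hG hP).differentiableAt one_ne_zero
  have hcov {W : VField E M} (hW : ContDiffAt ℝ 1 (rep p (iso W)) z)
      (a : TangentSpace 𝓘(ℝ, E) (lift p z).1) : comps p _ (D.cov (lift p z) W a) =
        Model.nab (D.christoffel p) (rep p (iso W)) z (comps p _ a) := by
    rw [← covField_iso, AnisotropicConnection.comps_covField hz' (hW.differentiableAt one_ne_zero)]
  -- the bracket in coordinates, by the absence of torsion
  have hc : comps p _ (VectorField.mlieBracket 𝓘(ℝ, E) X Y (lift p z).1) =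
      Model.nab (D.christoffel p) (rep p (iso Y)) z (rep p (iso X) z) -
        Model.nab (D.christoffel p) (rep p (iso X)) z (rep p (iso Y) z) := by
    have ht := hD.torsion_free _ hv X Y (hX.2.self_of_nhds.mdifferentiableAt (by simp))
      (hY.2.self_of_nhds.mdifferentiableAt (by simp))
    rw [sub_eq_zero] at ht
    rw [← ht, map_sub, hcov hY1, hcov hX1]
    rfl
  apply comps_injective (lift_fst_mem hz1)
  have hTA : ∀ᶠ z in 𝓝 z, ∀ b e, comps p _ ((tensorT F m σ D + tensorA F m σ D) (lift p z) b e) =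
      Model.diffTensor (D.christoffel p) (vproj F m σ p) z (comps p _ b) (comps p _ e) := by
    filter_upwards [hopen] with z hz using comps_tensorT_add_tensorA hσ hvert hz
  have hRT := rep_projCurvature (D := D) (S := top F m σ) m.isOpen_adm hz' hP
    (by filter_upwards [hopen] with z hz using rep_top hσ hvert hz) hX1 hY1 hZ2
  have hRB := rep_projCurvature (D := D) (S := bot F m σ) m.isOpen_adm hz'
    ((contDiffAt_const (c := ContinuousLinearMap.id ℝ E)).sub hP)
    (by filter_upwards [hopen] with z hz using rep_bot hσ hvert hz) hX1 hY1 hZ2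
  have hTAz := hTA.self_of_nhds
  have heq := Model.fundamental_equation hG hP hPP hX1 hY1 hZ2 hc
  rw [map_sub, map_add, map_sub, map_add, map_add,
    show comps p _ (curvatureTop F m σ D X Y Z (lift p z)) = _ from hRT,
    show comps p _ (curvatureBot F m σ D X Y Z (lift p z)) = _ from hRB,
    comps_covTensor hz' hK hTA,
    comps_covTensor hz' hK hTA, hTAz, hTAz, hTAz, hTAz,
    comps_curvature m.isOpen_adm hz' hX1 hY1 hZ2, ← hX.1, ← hY.1, ← hZ.1]
  exact heq
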